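/- Let $\mathbb{F}_q$ be a finite field, let $A$ be a geometrically integral projective curve over $\mathbb{F}_q$, let $P\in A(\mathbb{F}_q)$ be a rational point such that the local ring $\mathcal{O}_{A,P}$, with maximal ideal $\mathfrak{m}$, is regular (equivalently, $A$ is smooth over $\mathbb{F}_q$ at $P$), and let $y>0$ be an integer. Then there are a geometrically integral projective curve $Y$ over $\mathbb{F}_q$ and a morphism $u\colon A\to Y$ of $\mathbb{F}_q$-schemes such that 1. $u^{-1}(Y\setminus\{u(P)\})=A\setminus\{P\}$, and $u$ restricts to an isomorphism $A\setminus\{P\}\to Y\setminus\{u(P)\}$ (where $u(P)$ is a closed point of $Y$); 2. $p_a(Y)=p_a(A)+y$; 3. the local homomorphism $\mathcal{O}_{Y,u(P)}\to\mathcal{O}_{A,P}$ induced by $u$ is injective, with image $\mathbb{F}_q+\mathfrak{m}^{y+1}$. Here a curve is a scheme of dimension $1$, and $p_a(X)=1-\chi(\mathcal{O}_X)=1-\dim_{\mathbb{F}_q}H^0(X,\mathcal{O}_X)+\dim_{\mathbb{F}_q}H^1(X,\mathcal{O}_X)$ denotes the arithmetic genus of a projective curve $X$ over $\mathbb{F}_q$.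 -/

import Mathlib

open CategoryTheory AlgebraicGeometry Opposite TopologicalSpace

universe u

noncomputable section

namespace CurveGenus

attribute [local instance] MvPolynomial.gradedAlgebra

/-- Projective `n`-space over `k`, as `Proj` of the polynomial ring `k[x₀, …, xₙ]`. -/
def ProjSpace (k : Type u) [Field k] (n : ℕ) : Scheme.{u} :=
  Proj (MvPolynomial.homogeneousSubmodule (Fin (n + 1)) k)

/-- The structure morphism of projective `n`-space over `k`. -/
def ProjSpace.toSpec (k : Type u) [Field k] (n : ℕ) :
    ProjSpace k n ⟶ Spec (CommRingCat.of k) :=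
  Proj.toSpecZero (MvPolynomial.homogeneousSubmodule (Fin (n + 1)) k) ≫
    Spec.map (CommRingCat.ofHom
      (algebraMap k (MvPolynomial.homogeneousSubmodule (Fin (n + 1)) k 0)))

/-- A `k`-scheme is projective if it is a closed subscheme of some projective space over `k`. -/
def IsProjective {k : Type u} [Field k] {X : Scheme.{u}} (f : X ⟶ Spec (CommRingCat.of k)) :
    Prop :=
  ∃ (n : ℕ) (i : X ⟶ ProjSpace k n), IsClosedImmersion i ∧ i ≫ ProjSpace.toSpec k n = f

/-- Geometrically integral projective curves over `k`. -/
structure IsCurve {k : Type u} [Field k] {X : Scheme.{u}}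
    (f : X ⟶ Spec (CommRingCat.of k)) : Prop where
  projective : IsProjective f
  geometricallyIntegral : GeometricallyIntegral f
  dim_eq_one : topologicalKrullDim X = 1

section Cohomology

variable {k : Type u} [Field k] {X : Scheme.{u}} (f : X ⟶ Spec (CommRingCat.of k))

/-- The structure map `k → Γ(X, U)` of a `k`-scheme. -/
def scalarHom (U : X.Opens) : k →+* Γ(X, U) :=
  ((Scheme.ΓSpecIso (CommRingCat.of k)).inv ≫ f.appTop ≫
    X.presheaf.map (homOfLE (le_top : U ≤ ⊤)).op).hom

/-- The structure map `k → 𝒪_{X, x}` of a `k`-scheme. -/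
def stalkScalarHom (x : X) : k →+* X.presheaf.stalk x :=
  (X.presheaf.germ ⊤ x trivial).hom.comp (scalarHom f ⊤)

theorem map_scalarHom {U V : X.Opens} (i : V ⟶ U) (c : k) :
    (X.presheaf.map i.op).hom (scalarHom f U c) = scalarHom f V c := by
  have h : X.presheaf.map (homOfLE (le_top : U ≤ ⊤)).op ≫ X.presheaf.map i.op =
      X.presheaf.map (homOfLE (le_top : V ≤ ⊤)).op := by
    rw [← Functor.map_comp]; rfl
  simp only [scalarHom, ← h]
  rfl

/-- The structure sheaf, as a sheaf of abelian groups on the Zariski site. -/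
def structureSheafAb (X : Scheme.{u}) :
    Sheaf (Opens.grothendieckTopology X) AddCommGrpCat.{u} :=
  (sheafCompose (Opens.grothendieckTopology X) (forget₂ CommRingCat.{u} RingCat.{u} ⋙ forget₂ RingCat.{u} AddCommGrpCat.{u})).obj
    X.sheaf

/-- Multiplication by a scalar `c : k` on the structure sheaf. -/
def mulScalar (c : k) : structureSheafAb X ⟶ structureSheafAb X where
  hom :=
    { app U := AddCommGrpCat.ofHom (AddMonoidHom.mulLeft (scalarHom f U.unop c) :
        Γ(X, U.unop) →+ Γ(X, U.unop))
      naturality U V i := by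
        ext (s : Γ(X, U.unop))
        change scalarHom f V.unop c * (X.presheaf.map i).hom s =
          (X.presheaf.map i).hom (scalarHom f U.unop c * s)
        rw [map_mul]
        congr 1
        exact (map_scalarHom f i.unop c).symm }

/-- The sheaf cohomology group `Hⁿ(X, 𝒪_X)` of a `k`-scheme. -/
@[nolint unusedArguments]
def StructureCohomology {k : Type u} [Field k] {X : Scheme.{u}}
    (_f : X ⟶ Spec (CommRingCat.of k)) (n : ℕ) : Type u :=
  Sheaf.H.{u} (structureSheafAb X) n

instance (n : ℕ) : AddCommGroup (StructureCohomology f n) :=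
  inferInstanceAs (AddCommGroup (Sheaf.H.{u} (structureSheafAb X) n))

theorem mulScalar_one : mulScalar f 1 = 𝟙 _ := by
  ext U (s : Γ(X, U.unop))
  change scalarHom f U.unop 1 * s = s
  simp

theorem mulScalar_mul (c d : k) : mulScalar f (c * d) = mulScalar f d ≫ mulScalar f c := by
  ext U (s : Γ(X, U.unop))
  change scalarHom f U.unop (c * d) * s = scalarHom f U.unop c * (scalarHom f U.unop d * s)
  rw [map_mul, mul_assoc]

theorem mulScalar_add (c d : k) : mulScalar f (c + d) = mulScalar f c + mulScalar f d := by
  ext U (s : Γ(X, U.unop))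
  change scalarHom f U.unop (c + d) * s = scalarHom f U.unop c * s + scalarHom f U.unop d * s
  rw [map_add, add_mul]

/-- `k` acts on `Hⁿ(X, 𝒪_X)` by functoriality. -/
instance (n : ℕ) : Module k (StructureCohomology f n) where
  smul c x := Sheaf.H.map (mulScalar f c) n x
  one_smul x := by
    change Sheaf.H.map (mulScalar f 1) n x = x
    rw [mulScalar_one]; exact Sheaf.H.map_id_apply x
  mul_smul c d x := by
    change Sheaf.H.map (mulScalar f (c * d)) n x =
      Sheaf.H.map (mulScalar f c) n (Sheaf.H.map (mulScalar f d) n x)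
    rw [mulScalar_mul]; exact Sheaf.H.map_comp_apply _ _ x
  smul_zero c := map_zero (Sheaf.H.map (mulScalar f c) n)
  smul_add c := map_add (Sheaf.H.map (mulScalar f c) n)
  add_smul c d x := by
    change Sheaf.H.map (mulScalar f (c + d)) n x =
      Sheaf.H.map (mulScalar f c) n x + Sheaf.H.map (mulScalar f d) n x
    rw [mulScalar_add]; exact Sheaf.H.map_add_apply _ _ x
  zero_smul x := by
    have h : Sheaf.H.map (mulScalar f (0 + 0)) n x =
        Sheaf.H.map (mulScalar f 0) n x + Sheaf.H.map (mulScalar f 0) n x := by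
      rw [mulScalar_add]; exact Sheaf.H.map_add_apply _ _ x
    rw [add_zero] at h
    exact left_eq_add.mp h

/-- The arithmetic genus `p_a(X) = 1 - χ(𝒪_X) = 1 - (h⁰(𝒪_X) - h¹(𝒪_X))` of a projective curve
over `k` (the cohomology of a curve vanishes in degrees at least two). -/
def arithmeticGenus : ℤ :=
  1 - ((Module.finrank k (StructureCohomology f 0) : ℤ) -
    Module.finrank k (StructureCohomology f 1))

end Cohomology

end CurveGenus

end

-- Only the local ring at `P` has to change: `𝒪_{A,P}` is replaced by its subring `k + 𝔪^(y+1)`. To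
-- keep projectivity visible, `Y` is built as the scheme-theoretic image of a morphism from `A` to a
-- projective space.
--
-- A homogeneous `g` vanishing at `P` but not at the generic point has finitely many zeros on `A`,
-- all closed, and another homogeneous `f` avoids those zeros. Their nonvanishing loci are affine
-- opens `U ∋ P` and `V ∌ P` covering `A`, with functions `h` on `U` and `h'` on `V` which are
-- inverse to each other on `U ⊓ V` and invertible exactly there (`IsCurve.exists_charts`). Let `R`
-- be the ring of functions on `U` with germ at `P` in `k + 𝔪^(y+1)`. It has finite index in `Γ(U)`,
-- hence is finitely generated by Artin–Tate, and it contains `h^(y+1) Γ(U)`. Thus generators of `R`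
-- and of `Γ(V)`, scaled by high powers of `h` and `h'`, are the coordinates of a single morphism
-- whose image has coordinate rings `R` and `Γ(V)` (`exists_hom_projSpace_of_subring`,
-- `exists_image_projSpace`).
--
-- The map `u` is an isomorphism away from `P`, because the functions with germ in `𝔪^(y+1)` lie in
-- the conductor and have no common zero on `U` other than `P`
-- (`exists_isIso_morphismRestrict_compl`). Inverses modulo `𝔪^(y+1)` are powers, since the quotient
-- is finite, and this identifies the local ring at `u P` (`range_stalkMap_eq`).
--
-- For the genus, `H⁰` and `H¹` are computed by the Čech complex of two affine opens. The complexes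
-- of `Y` and `A` differ only by `R ⊆ Γ(U)`, of index `q^(y+1) / q = q^y` because `𝒪_{A,P}` is a
-- discrete valuation ring with residue field `k`. As `k` is finite, dimensions can be compared by
-- counting elements (`arithmeticGenus_eq_add`), once `H⁰` and `H¹` of `A` are known to be finite.

noncomputable section

-- First sheaf cohomology and covers by two open subsets.

namespace AbSheaf

variable {X : TopCat.{u}} (F G : Sheaf (Opens.grothendieckTopology X) AddCommGrpCat.{u})

/-- Restriction of sections of a sheaf of abelian groups. -/
def res {U V : Opens X} (h : V ≤ U) : F.obj.obj (op U) →+ F.obj.obj (op V) :=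
  (F.obj.map (homOfLE h).op).hom

/-- The map induced on sections by a morphism of sheaves. -/
def sec {F G : Sheaf (Opens.grothendieckTopology X) AddCommGrpCat.{u}} (f : F ⟶ G)
    (U : Opens X) : F.obj.obj (op U) →+ G.obj.obj (op U) :=
  (f.hom.app (op U)).hom

theorem res_res {U V W : Opens X} (h : V ≤ U) (h' : W ≤ V) (s : F.obj.obj (op U)) :
    res F h' (res F h s) = res F (h'.trans h) s := by
  change (F.obj.map _ ≫ F.obj.map _) s = _
  rw [← F.obj.map_comp]; rfl

theorem res_self {U : Opens X} (s : F.obj.obj (op U)) : res F le_rfl s = s := by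
  change F.obj.map (𝟙 (op U)) s = s
  rw [F.obj.map_id]; rfl

variable {F G}

theorem sec_res (f : F ⟶ G) {U V : Opens X} (h : V ≤ U) (s : F.obj.obj (op U)) :
    sec f V (res F h s) = res G h (sec f U s) := by
  change (F.obj.map _ ≫ f.hom.app _) s = (f.hom.app _ ≫ G.obj.map _) s
  rw [f.hom.naturality]

theorem ext_sup {U V T : Opens X} (hU : U ≤ T) (hV : V ≤ T) (hT : T ≤ U ⊔ V)
    {s t : F.obj.obj (op T)} (h₁ : res F hU s = res F hU t) (h₂ : res F hV s = res F hV t) :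
    s = t :=
  TopCat.Sheaf.eq_of_locally_eq₂ F (homOfLE hU) (homOfLE hV) hT s t h₁ h₂

theorem exists_glue {U V T : Opens X} (hU : U ≤ T) (hV : V ≤ T) (hT : T ≤ U ⊔ V)
    (s : F.obj.obj (op U)) (t : F.obj.obj (op V))
    (h : res F (inf_le_left : U ⊓ V ≤ U) s = res F (inf_le_right : U ⊓ V ≤ V) t) :
    ∃ r : F.obj.obj (op T), res F hU r = s ∧ res F hV r = t := by
  let f : Fin 2 → Opens X := ![U, V]
  let sf : (i : Fin 2) → F.obj.obj (op (f i))
    | 0 => s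
    | 1 => t
  have hT' : T ≤ iSup f := hT.trans (sup_le (le_iSup f 0) (le_iSup f 1))
  obtain ⟨r, hr, -⟩ := TopCat.Sheaf.existsUnique_gluing' F f T
    (Fin.cases (homOfLE hU) (fun i ↦ Fin.cases (homOfLE hV) (fun i ↦ i.elim0) i)) hT' sf (by
      simp only [TopCat.Presheaf.IsCompatible, Fin.forall_fin_two]
      refine ⟨⟨rfl, h⟩, Eq.symm ?_, rfl⟩
      have := congrArg (res F (le_of_eq (inf_comm V U))) h
      rwa [res_res, res_res] at this)
  exact ⟨r, hr 0, hr 1⟩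

section Exact

variable {S : ShortComplex (Sheaf (Opens.grothendieckTopology X) AddCommGrpCat.{u})}
  (hS : S.ShortExact)
include hS

theorem sec_f_injective (U : Opens X) : Function.Injective (sec S.f U) := by
  have := hS.mono_f
  have : Mono (S.f.hom.app (op U)) := inferInstance
  exact (AddCommGrpCat.mono_iff_injective _).mp this

theorem exists_sec_f_eq {U : Opens X} {s : S.X₂.obj.obj (op U)} (h : sec S.g U s = 0) :
    ∃ t, sec S.f U t = s :=
  TopCat.Sheaf.sections_exact_of_left_exact hS.1 hS.2 s h

omit hS in
theorem sec_g_sec_f {U : Opens X} (t : S.X₁.obj.obj (op U)) : sec S.g U (sec S.f U t) = 0 := by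
  change (S.f.hom.app _ ≫ S.g.hom.app _) t = 0
  have : (S.f.hom.app (op U) ≫ S.g.hom.app (op U)) = 0 := by
    rw [← NatTrans.comp_app, ← ObjectProperty.FullSubcategory.comp_hom, S.zero]
    rfl
  rw [this]; rfl

theorem exists_local_lift {U : Opens X} (s : S.X₃.obj.obj (op U)) {x : X} (hx : x ∈ U) :
    ∃ (V : Opens X) (hV : V ≤ U) (t : S.X₂.obj.obj (op V)), x ∈ V ∧ sec S.g V t = res S.X₃ hV s := by
  have := (TopCat.Sheaf.isLocallySurjective_iff_epi S.g).mpr hS.epi_g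
  obtain ⟨V, hV, ⟨t, ht⟩, hxV⟩ :=
    (TopCat.Presheaf.isLocallySurjective_iff S.g.hom).mp this U s x hx
  exact ⟨V, hV, t, hxV, ht⟩

end Exact

/-- Sections of an injective sheaf of abelian groups extend to larger open subsets. -/
theorem exists_res_eq_of_injective [Injective F] {U V : Opens X} (h : V ≤ U)
    (s : F.obj.obj (op V)) : ∃ t, res F h t = s := by
  let J := Opens.grothendieckTopology X
  -- The sheafification of the free presheaf on `W` represents sections over `W`, and `V ≤ U`
  -- induces a monomorphism between these sheaves, along which morphisms into `F` extend.
  let P (W : Opens X) : (Opens X)ᵒᵖ ⥤ AddCommGrpCat.{u} := yoneda.obj W ⋙ AddCommGrpCat.free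
  let j : P V ⟶ P U := Functor.whiskerRight (yoneda.map (homOfLE h)) AddCommGrpCat.free
  have : Mono ((presheafToSheaf J AddCommGrpCat.{u}).map j) := inferInstance
  let e (W : Opens X) : ((presheafToSheaf J AddCommGrpCat.{u}).obj (P W) ⟶ F) ≃
      F.obj.obj (op W) :=
    ((sheafificationAdjunction J AddCommGrpCat.{u}).homEquiv (P W) F).trans
      (((AddCommGrpCat.adj.whiskerRight (Opens X)ᵒᵖ).homEquiv (yoneda.obj W) F.obj).trans
        yonedaEquiv)
  obtain ⟨g, hg⟩ := Injective.factors ((e V).symm s) ((presheafToSheaf J AddCommGrpCat.{u}).map j)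
  refine ⟨e U g, ?_⟩
  rw [← (e V).apply_symm_apply s, ← hg]
  simp only [e, Equiv.trans_apply]
  rw [Adjunction.homEquiv_naturality_left]
  erw [Adjunction.homEquiv_naturality_left]
  exact yonedaEquiv_naturality (F := F.obj ⋙ forget AddCommGrpCat.{u}) _ (homOfLE h)

/-- The connecting homomorphism of a short exact sequence with injective middle term. -/
theorem exists_connecting_hom {S : ShortComplex (Sheaf (Opens.grothendieckTopology X) AddCommGrpCat.{u})}
    (hS : S.ShortExact) [Injective S.X₂] :
    ∃ δ : S.X₃.obj.obj (op ⊤) →+ Sheaf.H.{u} S.X₁ 1, Function.Surjective δ ∧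
      ∀ q, δ q = 0 ↔ ∃ i, sec S.g ⊤ i = q := by
  have hT : Limits.IsTerminal (⊤ : Opens X) := Preorder.isTerminalTop _
  let δ : S.X₃.obj.obj (op ⊤) →+ Sheaf.H.{u} S.X₁ 1 :=
    (hS.extClass.postcomp _ (zero_add 1)).comp (Sheaf.H.equiv₀ S.X₃ hT).symm.toAddMonoidHom
  refine ⟨δ, fun x ↦ ?_, fun q ↦ ⟨fun h ↦ ?_, ?_⟩⟩
  · obtain ⟨y, hy⟩ := Abelian.Ext.covariant_sequence_exact₁ _ hS x
      (Abelian.Ext.eq_zero_of_injective _) (zero_add 1)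
    exact ⟨Sheaf.H.equiv₀ S.X₃ hT y, by simpa [δ] using hy⟩
  · obtain ⟨y, hy⟩ := Abelian.Ext.covariant_sequence_exact₃ _ hS
      ((Sheaf.H.equiv₀ S.X₃ hT).symm q) (zero_add 1) h
    refine ⟨Sheaf.H.equiv₀ S.X₂ hT y, ?_⟩
    refine (Sheaf.H.equiv₀_naturality hT S.g y).trans ?_
    exact ((Sheaf.H.equiv₀ S.X₃ hT).symm_apply_eq.mp hy.symm).symm
  · rintro ⟨i, rfl⟩
    have := Sheaf.H.equiv₀_symm_naturality hT S.g i
    change Abelian.Ext.comp ((Sheaf.H.equiv₀ S.X₃ hT).symm (S.g.hom.app (op ⊤) i)) hS.extClass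
      (zero_add 1) = 0
    rw [← this, Sheaf.H.map_apply, Abelian.Ext.comp_assoc_of_second_deg_zero, hS.comp_extClass,
      Abelian.Ext.comp_zero]

/-- Goursat's lemma for a relation which is injective in one direction. -/
theorem exists_equiv_quotient_of_relation {M N : Type*} [AddCommGroup M] [AddCommGroup N]
    (R : AddSubgroup (M × N)) (hM : ∀ m, ∃ n, (m, n) ∈ R) (hN : ∀ n, ∃ m, (m, n) ∈ R)
    (h₀ : ∀ m, (m, 0) ∈ R → m = 0) (K : AddSubgroup N) (hK : ∀ n, (0, n) ∈ R ↔ n ∈ K) :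
    Nonempty (M ≃+ N ⧸ K) := by
  choose φ hφ using hN
  have huniq {n m m'} (h : (m, n) ∈ R) (h' : (m', n) ∈ R) : m = m' :=
    sub_eq_zero.mp (h₀ _ (by simpa using R.sub_mem h h'))
  let φ' : N →+ M :=
    { toFun := φ
      map_zero' := huniq (hφ 0) R.zero_mem
      map_add' := fun a b ↦ huniq (hφ _) (R.add_mem (hφ a) (hφ b)) }
  have hker : K = φ'.ker := by
    ext n
    rw [← hK, AddMonoidHom.mem_ker]
    exact ⟨fun h ↦ huniq (hφ n) h, fun h ↦ h ▸ hφ n⟩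
  have hsurj : Function.Surjective φ' := fun m ↦ by
    obtain ⟨n, hn⟩ := hM m
    exact ⟨n, huniq (hφ n) hn⟩
  exact ⟨((QuotientAddGroup.quotientAddEquivOfEq hker).trans
    (QuotientAddGroup.quotientKerEquivOfSurjective φ' hsurj)).symm⟩

/-- Mayer–Vietoris for two opens without first cohomology. The hypotheses `hU` and `hV` encode this
vanishing as surjectivity on sections for every short exact sequence starting with `F`, so no
cohomology of open subsets is needed. -/
theorem exists_H_one_equiv_quotient (U V : Opens X) (hUV : U ⊔ V = ⊤)
    (hU : ∀ {I Q : Sheaf (Opens.grothendieckTopology X) AddCommGrpCat.{u}} (f : F ⟶ I) (g : I ⟶ Q)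
      (w : f ≫ g = 0), (ShortComplex.mk f g w).ShortExact → Function.Surjective (sec g U))
    (hV : ∀ {I Q : Sheaf (Opens.grothendieckTopology X) AddCommGrpCat.{u}} (f : F ⟶ I) (g : I ⟶ Q)
      (w : f ≫ g = 0), (ShortComplex.mk f g w).ShortExact → Function.Surjective (sec g V)) :
    Nonempty (Sheaf.H.{u} F 1 ≃+ F.obj.obj (op (U ⊓ V)) ⧸
      ((res F (inf_le_left : U ⊓ V ≤ U)).range ⊔ (res F (inf_le_right : U ⊓ V ≤ V)).range)) := by
  let I := Injective.under F
  let f : F ⟶ I := Injective.ι F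
  let S : ShortComplex (Sheaf (Opens.grothendieckTopology X) AddCommGrpCat.{u}) :=
    ShortComplex.mk f (Limits.cokernel.π f) (Limits.cokernel.condition f)
  have hS : S.ShortExact :=
    { exact := ShortComplex.exact_cokernel f
      mono_f := inferInstanceAs (Mono f)
      epi_g := inferInstanceAs (Epi (Limits.cokernel.π f)) }
  have : Injective S.X₂ := inferInstanceAs (Injective (Injective.under F))
  let Q := S.X₃
  let g : I ⟶ Q := S.g
  have hfi (W) : Function.Injective (sec f W) := sec_f_injective hS W
  have hex {W} {s : I.obj.obj (op W)} (h : sec g W s = 0) : ∃ t, sec f W t = s :=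
    exists_sec_f_eq hS h
  have hgf {W} (t : F.obj.obj (op W)) : sec g W (sec f W t) = 0 := sec_g_sec_f (S := S) t
  obtain ⟨δ, hδ, hδ'⟩ := exists_connecting_hom hS
  -- A class `δ q` is related to the difference, on `U ⊓ V`, of lifts of `q` over `U` and over `V`.
  -- The relation avoids proving independence of these choices in advance.
  let R : AddSubgroup (Sheaf.H.{u} F 1 × F.obj.obj (op (U ⊓ V))) :=
    { carrier := {p | ∃ (q : Q.obj.obj (op ⊤)) (s : I.obj.obj (op U)) (t : I.obj.obj (op V)),
        δ q = p.1 ∧ sec g U s = res Q le_top q ∧ sec g V t = res Q le_top q ∧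
        sec f _ p.2 = res I inf_le_left s - res I inf_le_right t}
      zero_mem' := ⟨0, 0, 0, by simp⟩
      add_mem' := by
        rintro a b ⟨q, s, t, h₁, h₂, h₃, h₄⟩ ⟨q', s', t', h₁', h₂', h₃', h₄'⟩
        refine ⟨q + q', s + s', t + t', ?_, ?_, ?_, ?_⟩
        · simp [h₁, h₁']
        · simp [h₂, h₂']
        · simp [h₃, h₃']
        · simp only [Prod.snd_add, map_add, h₄, h₄']; abel
      neg_mem' := by
        rintro a ⟨q, s, t, h₁, h₂, h₃, h₄⟩
        refine ⟨-q, -s, -t, ?_, ?_, ?_, ?_⟩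
        · simp [h₁]
        · simp [h₂]
        · simp [h₃]
        · simp only [Prod.snd_neg, map_neg, h₄]; abel }
  have hR₁ (x : Sheaf.H.{u} F 1) : ∃ c, (x, c) ∈ R := by
    obtain ⟨q, rfl⟩ := hδ x
    obtain ⟨s, hs⟩ := hU f g S.zero hS (res Q le_top q)
    obtain ⟨t, ht⟩ := hV f g S.zero hS (res Q le_top q)
    obtain ⟨c, hc⟩ := hex (s := res I inf_le_left s - res I (inf_le_right : U ⊓ V ≤ V) t) (by
      rw [map_sub, sec_res, sec_res, hs, ht, res_res, res_res, sub_self])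
    exact ⟨c, q, s, t, rfl, hs, ht, hc⟩
  -- Extend `f c` to a section `s` of the injective sheaf over `U`. Its image in `Q` vanishes on `U
  -- ⊓ V`, so it glues with zero on `V`.
  have hR₂ (c) : ∃ x, (x, c) ∈ R := by
    obtain ⟨s, hs⟩ := exists_res_eq_of_injective (inf_le_left : U ⊓ V ≤ U) (sec f _ c)
    obtain ⟨q, hq, hq'⟩ := exists_glue (le_top : U ≤ ⊤) (le_top : V ≤ ⊤) hUV.ge (sec g U s) 0 (by
      rw [← sec_res, hs, hgf, map_zero])
    exact ⟨δ q, q, s, 0, rfl, hq.symm, by rw [hq', map_zero], by simp [hs]⟩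
  refine exists_equiv_quotient_of_relation R hR₁ hR₂ ?_ _ fun c ↦ ?_
  · rintro _ ⟨q, s, t, rfl, h₂, h₃, h₄⟩
    have h₅ : res I (inf_le_left : U ⊓ V ≤ U) s = res I inf_le_right t :=
      sub_eq_zero.mp (by rw [← h₄]; exact map_zero _)
    obtain ⟨i, rfl, rfl⟩ := exists_glue (le_top : U ≤ ⊤) (le_top : V ≤ ⊤) hUV.ge s t h₅
    refine (hδ' _).mpr ⟨i, ext_sup le_top le_top hUV.ge ?_ ?_⟩
    · rw [← sec_res, ← h₂]
    · rw [← sec_res, ← h₃]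
  · rw [AddSubgroup.mem_sup]
    constructor
    · rintro ⟨q, s, t, h₁, h₂, h₃, h₄⟩
      obtain ⟨i, rfl⟩ := (hδ' _).mp h₁
      obtain ⟨a, ha⟩ := hex (s := s - res I le_top i) (by
        rw [map_sub, h₂, sec_res, sub_self])
      obtain ⟨b, hb⟩ := hex (s := t - res I le_top i) (by
        rw [map_sub, h₃, sec_res, sub_self])
      refine ⟨_, ⟨a, rfl⟩, _, ⟨-b, rfl⟩, hfi _ ?_⟩
      rw [h₄, map_add, map_neg, map_neg, sec_res, sec_res, ha, hb, map_sub, map_sub, res_res,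
        res_res]
      abel
    · rintro ⟨_, ⟨a, rfl⟩, _, ⟨b, rfl⟩, rfl⟩
      refine ⟨0, sec f _ a, sec f _ (-b), map_zero _, ?_, ?_, ?_⟩
      · rw [hgf, map_zero]
      · rw [hgf, map_zero]
      · simp only [map_add, sec_res, map_neg, sub_neg_eq_add]

end AbSheaf

-- Vanishing on affine opens, and the Čech description of `H¹(𝒪)`.

namespace AbSheaf

theorem eq_of_le_bot {X : TopCat.{u}} {F : Sheaf (Opens.grothendieckTopology X) AddCommGrpCat.{u}}
    {U : Opens X} (h : U ≤ ⊥) (s t : F.obj.obj (op U)) : s = t :=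
  TopCat.Sheaf.eq_of_locally_eq' F (fun i : PEmpty.{1} ↦ i.elim) U (fun i ↦ i.elim)
    (h.trans bot_le) s t (fun i ↦ i.elim)

/-- Two local lifts differ on the overlap by a section of the kernel. Splitting that section as `a +
b` and correcting the lifts by `-a` and `+b` makes them glue. -/
theorem exists_lift_sup {X : TopCat.{u}}
    {S : ShortComplex (Sheaf (Opens.grothendieckTopology X) AddCommGrpCat.{u})}
    (hS : S.ShortExact) {U V T : Opens X} (hU : U ≤ T) (hV : V ≤ T) (hT : T ≤ U ⊔ V)
    (hUV : ∀ c : S.X₁.obj.obj (op (U ⊓ V)), ∃ a b,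
      c = res S.X₁ (inf_le_left : U ⊓ V ≤ U) a + res S.X₁ (inf_le_right : U ⊓ V ≤ V) b)
    (q : S.X₃.obj.obj (op T)) (hqU : ∃ s, sec S.g U s = res S.X₃ hU q)
    (hqV : ∃ s, sec S.g V s = res S.X₃ hV q) : ∃ s, sec S.g T s = q := by
  obtain ⟨s, hs⟩ := hqU
  obtain ⟨t, ht⟩ := hqV
  obtain ⟨c, hc⟩ := exists_sec_f_eq hS
    (s := res S.X₂ (inf_le_left : U ⊓ V ≤ U) s - res S.X₂ (inf_le_right : U ⊓ V ≤ V) t) (by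
      rw [map_sub, sec_res, sec_res, hs, ht, res_res, res_res, sub_self])
  obtain ⟨a, b, rfl⟩ := hUV c
  rw [map_add, sec_res, sec_res] at hc
  obtain ⟨r, hr, hr'⟩ := exists_glue hU hV hT (s - sec S.f U a) (t + sec S.f V b) (by
    rw [map_sub, map_add, sub_eq_iff_eq_add, ← sub_eq_iff_eq_add', ← sub_sub,
      sub_eq_iff_eq_add, ← hc])
  refine ⟨r, ext_sup hU hV hT ?_ ?_⟩
  · rw [← sec_res, hr, map_sub, hs, sec_g_sec_f, sub_zero]
  · rw [← sec_res, hr', map_add, ht, sec_g_sec_f, add_zero]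

end AbSheaf

namespace CurveGenus

open AbSheaf

variable {X : Scheme.{u}}

/-- Restriction of functions, as a ring homomorphism. -/
def resHom (X : Scheme.{u}) {U V : X.Opens} (h : V ≤ U) : Γ(X, U) →+* Γ(X, V) :=
  (X.presheaf.map (homOfLE h).op).hom

theorem resHom_resHom {U V W : X.Opens} (h : V ≤ U) (h' : W ≤ V) (s : Γ(X, U)) :
    resHom X h' (resHom X h s) = resHom X (h'.trans h) s := by
  change (X.presheaf.map _ ≫ X.presheaf.map _) s = _
  rw [← X.presheaf.map_comp]; rfl

theorem isUnit_resHom_basicOpen {U V : X.Opens} (h : V ≤ U) {f : Γ(X, U)}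
    (hf : V ≤ X.basicOpen f) : IsUnit (resHom X h f) := by
  have := (X.toRingedSpace.isUnit_res_basicOpen f).map (resHom X hf)
  have e : resHom X hf (resHom X (X.basicOpen_le f) f) = resHom X h f := resHom_resHom _ _ _
  rwa [← e]

theorem exists_pow_mul_eq_resHom {U V : X.Opens} (hU : IsAffineOpen U) (f : Γ(X, U))
    (hV : V = X.basicOpen f) (h : V ≤ U) (c : Γ(X, V)) :
    ∃ (n : ℕ) (x : Γ(X, U)), c * resHom X h f ^ n = resHom X h x := by
  subst hV
  have := hU.isLocalization_basicOpen f
  obtain ⟨n, x, hx⟩ := IsLocalization.Away.surj f c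
  exact ⟨n, x, hx⟩

/-- Write `c = x / (f g)^n` and `α f^n + β g^n = 1`; then `c = β x / f^n + α x / g^n`. -/
theorem exists_resHom_add_eq {U V W T : X.Opens} (hT : IsAffineOpen T) {f g : Γ(X, T)}
    (hfg : IsCoprime f g) (hU : U = X.basicOpen f) (hV : V = X.basicOpen g)
    (hWU : W ≤ U) (hWV : W ≤ V) (hW : W = U ⊓ V)
    (c : Γ(X, W)) : ∃ a b, c = resHom X hWU a + resHom X hWV b := by
  have hUT : U ≤ T := hU ▸ X.basicOpen_le f
  have hVT : V ≤ T := hV ▸ X.basicOpen_le g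
  have hWT : W ≤ T := hWU.trans hUT
  have hWe : W = X.basicOpen (f * g) := by rw [X.basicOpen_mul, hW, hU, hV]
  obtain ⟨n, x, hx⟩ := exists_pow_mul_eq_resHom hT (f * g) hWe hWT c
  obtain ⟨α, β, hαβ⟩ := (hfg.pow : IsCoprime (f ^ n) (g ^ n))
  obtain ⟨uf, huf⟩ := isUnit_resHom_basicOpen hUT hU.le
  obtain ⟨ug, hug⟩ := isUnit_resHom_basicOpen hVT hV.le
  refine ⟨resHom X hUT (β * x) * ↑(uf⁻¹ ^ n), resHom X hVT (α * x) * ↑(ug⁻¹ ^ n), ?_⟩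
  have hF : resHom X hWU ↑(uf⁻¹ ^ n) * resHom X hWT f ^ n = 1 := by
    rw [← resHom_resHom hUT hWU f, ← huf, ← map_pow, ← map_mul, inv_pow, ← Units.val_pow_eq_pow_val,
      Units.inv_mul, map_one]
  have hG : resHom X hWV ↑(ug⁻¹ ^ n) * resHom X hWT g ^ n = 1 := by
    rw [← resHom_resHom hVT hWV g, ← hug, ← map_pow, ← map_mul, inv_pow, ← Units.val_pow_eq_pow_val,
      Units.inv_mul, map_one]
  have h1 : resHom X hWT α * resHom X hWT f ^ n + resHom X hWT β * resHom X hWT g ^ n = 1 := by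
    rw [← map_pow, ← map_pow, ← map_mul, ← map_mul, ← map_add, hαβ, map_one]
  rw [map_mul (resHom X hWT)] at hx
  rw [map_mul (resHom X hWU), map_mul (resHom X hWV), resHom_resHom, resHom_resHom,
    map_mul (resHom X hWT), map_mul (resHom X hWT), ← hx]
  linear_combination (-c) * h1 - c * resHom X hWT β * resHom X hWT g ^ n * hF
    - c * resHom X hWT α * resHom X hWT f ^ n * hG

/-- The structure sheaf has no first cohomology on affine open subsets. -/
theorem sec_surjective_of_isAffineOpen {U : X.Opens} (hU : IsAffineOpen U)
    {I Q : Sheaf (Opens.grothendieckTopology X) AddCommGrpCat.{u}} (f : structureSheafAb X ⟶ I)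
    (g : I ⟶ Q) (w : f ≫ g = 0) (hS : (ShortComplex.mk f g w).ShortExact) :
    Function.Surjective (sec g U) := by
  intro q
  -- The functions `r` such that `q` lifts over `D(r)` form an ideal: on `D(r + r')` the
  -- restrictions of `r` and `r'` are coprime, so the two lifts can be corrected and glued. Local
  -- lifts show that no maximal ideal contains it.
  let J : Ideal Γ(X, U) :=
    { carrier := {r | ∃ s, sec g _ s = res Q (X.basicOpen_le r) q}
      zero_mem' := by
        refine ⟨0, ?_⟩
        exact eq_of_le_bot (by simp) _ _
      add_mem' := by
        rintro r r' ⟨s, hs⟩ ⟨s', hs'⟩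
        have hD := X.basicOpen_le (r + r')
        let T := X.basicOpen (r + r')
        have hT : IsAffineOpen T := hU.basicOpen (r + r')
        let r₁ : Γ(X, T) := resHom X hD r
        let r₂ : Γ(X, T) := resHom X hD r'
        have h₁ : X.basicOpen r₁ = T ⊓ X.basicOpen r := X.basicOpen_res _ _
        have h₂ : X.basicOpen r₂ = T ⊓ X.basicOpen r' := X.basicOpen_res _ _
        have hc : IsCoprime r₁ r₂ := by
          have hu : IsUnit (r₁ + r₂) := by
            rw [← map_add]; exact isUnit_resHom_basicOpen _ le_rfl
          obtain ⟨v, hv⟩ := hu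
          exact ⟨↑v⁻¹, ↑v⁻¹, by rw [← mul_add, ← hv, Units.inv_mul]⟩
        refine exists_lift_sup hS (X.basicOpen_le r₁) (X.basicOpen_le r₂) ?_
          (exists_resHom_add_eq hT hc rfl rfl inf_le_left inf_le_right rfl) _
          ⟨res I (h₁.trans_le inf_le_right) s, ?_⟩ ⟨res I (h₂.trans_le inf_le_right) s', ?_⟩
        · rw [h₁, h₂, ← inf_sup_left]
          exact le_inf le_rfl (X.basicOpen_add_le _ _)
        · exact (sec_res ..).trans (by rw [hs, res_res, res_res])
        · exact (sec_res ..).trans (by rw [hs', res_res, res_res])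
      smul_mem' := by
        rintro r r' ⟨s, hs⟩
        have h : X.basicOpen (r • r') ≤ X.basicOpen r' := by
          rw [smul_eq_mul, X.basicOpen_mul]; exact inf_le_right
        exact ⟨res I h s, by rw [sec_res, hs, res_res]⟩ }
  have hJ : J = ⊤ := by
    by_contra hJ
    obtain ⟨m, hm, hJm⟩ := J.exists_le_maximal hJ
    let x : X := hU.fromSpec ⟨m, hm.isPrime⟩
    have hx : x ∈ U := by
      have : x ∈ Set.range hU.fromSpec := ⟨_, rfl⟩
      rwa [hU.range_fromSpec] at this
    obtain ⟨V, hV, t, hxV, ht⟩ := exists_local_lift hS q hx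
    obtain ⟨r, hr, hxr⟩ := hU.exists_basicOpen_le ⟨x, hxV⟩ hx
    have hrJ : r ∈ J := ⟨res I hr t, (sec_res ..).trans (by
      have := congrArg (res Q hr) ht
      rwa [res_res] at this)⟩
    have : (⟨m, hm.isPrime⟩ : PrimeSpectrum Γ(X, U)) ∈ hU.fromSpec ⁻¹ᵁ X.basicOpen r := hxr
    rw [hU.fromSpec_preimage_basicOpen] at this
    exact this (hJm hrJ)
  have h1 : (1 : Γ(X, U)) ∈ J := hJ ▸ Submodule.mem_top
  obtain ⟨s, hs⟩ := h1
  have e : U ≤ X.basicOpen (1 : Γ(X, U)) := by rw [X.basicOpen_of_isUnit isUnit_one]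
  refine ⟨res I e s, ?_⟩
  rw [sec_res, hs, res_res, res_self]

/-- The first cohomology of the structure sheaf, computed with two affine open subsets. -/
theorem exists_H_one_equiv {k : Type u} [Field k] (f : X ⟶ Spec (CommRingCat.of k))
    {U V : X.Opens} (hU : IsAffineOpen U) (hV : IsAffineOpen V) (hUV : U ⊔ V = ⊤) :
    Nonempty (StructureCohomology f 1 ≃+ Γ(X, U ⊓ V) ⧸
      ((resHom X (inf_le_left : U ⊓ V ≤ U)).toAddMonoidHom.range ⊔
        (resHom X (inf_le_right : U ⊓ V ≤ V)).toAddMonoidHom.range)) :=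
  exists_H_one_equiv_quotient (F := structureSheafAb X) U V hUV
    (sec_surjective_of_isAffineOpen hU) (sec_surjective_of_isAffineOpen hV)

/-- The zeroth cohomology of the structure sheaf. -/
def HZeroEquiv {k : Type u} [Field k] (f : X ⟶ Spec (CommRingCat.of k)) :
    StructureCohomology f 0 ≃+ Γ(X, ⊤) :=
  Sheaf.H.equiv₀ (structureSheafAb X) (Preorder.isTerminalTop _)

end CurveGenus

-- Comparison of arithmetic genera by counting.

/-- Change of the Euler characteristic of `d : M → N` when `M` is replaced by a subgroup. In
multiplicative form no finiteness is needed: infinite cardinals and indices count as `0`. -/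
theorem AddMonoidHom.card_ker_mul_index_range_comp {L M N : Type*} [AddCommGroup L] [AddCommGroup M]
    [AddCommGroup N] (i : L →+ M) (hi : Function.Injective i) (d : M →+ N) :
    Nat.card d.ker * (d.comp i).range.index =
      Nat.card (d.comp i).ker * i.range.index * d.range.index := by
  have e : (d.comp i).ker ≃ (i.range ⊓ d.ker : AddSubgroup M) :=
    Equiv.ofBijective (fun x ↦ ⟨i x.1, ⟨x.1, rfl⟩, x.2⟩)
      ⟨fun x y h ↦ Subtype.ext (hi (congrArg Subtype.val h)),
        fun ⟨_, ⟨x, rfl⟩, h⟩ ↦ ⟨⟨x, h⟩, rfl⟩⟩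
  have h₁ : (d.comp i).range.index = (i.range ⊔ d.ker).index * d.range.index := by
    rw [AddMonoidHom.range_comp, AddSubgroup.index_map]
  have h₂ := AddSubgroup.relIndex_mul_index (le_sup_left : i.range ≤ i.range ⊔ d.ker)
  rw [AddSubgroup.relIndex_sup_left] at h₂
  have h₃ : Nat.card (i.range ⊓ d.ker : AddSubgroup M) * i.range.relIndex d.ker
      = Nat.card d.ker := by
    rw [← AddSubgroup.inf_relIndex_right, ← AddSubgroup.relIndex_bot_left,
      ← AddSubgroup.relIndex_bot_left, AddSubgroup.relIndex_mul_relIndex _ _ _ bot_le inf_le_right]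
  rw [h₁, Nat.card_congr e, ← h₂, ← h₃]
  ring

namespace CurveGenus

/-- The Čech differential of the structure sheaf for two open subsets. -/
def cechDiff (X : Scheme.{u}) (U V : X.Opens) : Γ(X, U) × Γ(X, V) →+ Γ(X, U ⊓ V) :=
  (resHom X (inf_le_left : U ⊓ V ≤ U)).toAddMonoidHom.coprod
    (resHom X (inf_le_right : U ⊓ V ≤ V)).toAddMonoidHom

variable {k : Type u} [Field k] {X : Scheme.{u}} (f : X ⟶ Spec (CommRingCat.of k))
  {U V : X.Opens}

theorem card_H_one_eq (hU : IsAffineOpen U) (hV : IsAffineOpen V) (hUV : U ⊔ V = ⊤) :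
    Nat.card (StructureCohomology f 1) = (cechDiff X U V).range.index := by
  obtain ⟨e⟩ := exists_H_one_equiv f hU hV hUV
  have h : (cechDiff X U V).range = (resHom X (inf_le_left : U ⊓ V ≤ U)).toAddMonoidHom.range ⊔
      (resHom X (inf_le_right : U ⊓ V ≤ V)).toAddMonoidHom.range := by
    ext x
    rw [AddSubgroup.mem_sup]
    exact ⟨fun ⟨p, hp⟩ ↦ ⟨_, ⟨p.1, rfl⟩, _, ⟨p.2, rfl⟩, hp⟩,
      fun ⟨_, ⟨a, rfl⟩, _, ⟨b, rfl⟩, hp⟩ ↦ ⟨(a, b), hp⟩⟩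
  rw [Nat.card_congr e.toEquiv, h]
  rfl

theorem card_H_zero_eq (hUV : U ⊔ V = ⊤) :
    Nat.card (StructureCohomology f 0) = Nat.card (cechDiff X U V).ker := by
  rw [Nat.card_congr (HZeroEquiv f).toEquiv]
  refine Nat.card_congr (Equiv.ofBijective
    (fun s ↦ ⟨(resHom X le_top s, -resHom X le_top s), ?_⟩) ⟨fun s t h ↦ ?_, fun p ↦ ?_⟩)
  · change resHom X _ (resHom X _ s) + resHom X _ (- resHom X _ s) = 0
    rw [map_neg, resHom_resHom, resHom_resHom, add_neg_cancel]
  · have h := congrArg Subtype.val h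
    refine AbSheaf.ext_sup (F := structureSheafAb X) (le_top : U ≤ ⊤) (le_top : V ≤ ⊤) hUV.ge
      (congrArg Prod.fst h) (neg_injective (congrArg Prod.snd h))
  · obtain ⟨⟨s, t⟩, h⟩ := p
    have h : resHom X inf_le_left s + resHom X inf_le_right t = 0 := h
    obtain ⟨r, hr, hr'⟩ := AbSheaf.exists_glue (F := structureSheafAb X) (le_top : U ≤ ⊤)
      (le_top : V ≤ ⊤) hUV.ge s (-t)
      ((eq_neg_of_add_eq_zero_left h).trans (map_neg (resHom X (inf_le_right : U ⊓ V ≤ V)) t).symm)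
    exact ⟨r, Subtype.ext (Prod.ext hr (neg_eq_iff_eq_neg.mpr hr'))⟩

variable [Finite k] {Y : Scheme.{u}} (g : Y ⟶ Spec (CommRingCat.of k))

theorem app_resHom {X Y : Scheme.{u}} (u : X ⟶ Y) {T T' : Y.Opens} (h : T ≤ T') (s : Γ(Y, T')) :
    (u.app T).hom (resHom Y h s) = resHom X (u.preimage_mono h) ((u.app T').hom s) :=
  congr($(u.naturality (homOfLE h).op) s)

/-- Comparison of arithmetic genera along a morphism which is an isomorphism away from an affine
open subset on which it has finite index. -/
theorem arithmeticGenus_eq_add (u : X ⟶ Y) {Y₀ Y₁ : Y.Opens} (h₀ : IsAffineOpen Y₀)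
    (h₁ : IsAffineOpen Y₁) (h₀₁ : Y₀ ⊔ Y₁ = ⊤) (h₀' : IsAffineOpen (u ⁻¹ᵁ Y₀))
    (h₁' : IsAffineOpen (u ⁻¹ᵁ Y₁)) (hinj : Function.Injective (u.app Y₀).hom)
    (y : ℕ) (hidx : (u.app Y₀).hom.toAddMonoidHom.range.index = Nat.card k ^ y)
    (hbij : Function.Bijective (u.app Y₁).hom) (hbij' : Function.Bijective (u.app (Y₀ ⊓ Y₁)).hom)
    [Finite (StructureCohomology f 0)] [Finite (StructureCohomology f 1)] :
    arithmeticGenus g = arithmeticGenus f + y := by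
  have htop : (u ⁻¹ᵁ Y₀) ⊔ (u ⁻¹ᵁ Y₁) = ⊤ := by
    rw [← Scheme.Hom.preimage_sup, h₀₁]; rfl
  let i : Γ(Y, Y₀) × Γ(Y, Y₁) →+ Γ(X, u ⁻¹ᵁ Y₀) × Γ(X, u ⁻¹ᵁ Y₁) :=
    (u.app Y₀).hom.toAddMonoidHom.prodMap (u.app Y₁).hom.toAddMonoidHom
  let e : Γ(Y, Y₀ ⊓ Y₁) ≃+ Γ(X, u ⁻¹ᵁ Y₀ ⊓ u ⁻¹ᵁ Y₁) :=
    AddEquiv.ofBijective (u.app (Y₀ ⊓ Y₁)).hom.toAddMonoidHom hbij'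
  have hi : Function.Injective i := hinj.prodMap hbij.1
  have hirange : i.range.index = Nat.card k ^ y := by
    have : i.range = (u.app Y₀).hom.toAddMonoidHom.range.prod
        (u.app Y₁).hom.toAddMonoidHom.range := AddMonoidHom.range_prodMap _ _
    rw [this, AddSubgroup.index_prod, hidx, AddMonoidHom.range_eq_top.mpr hbij.2]
    simp
  have hcomm : (cechDiff X (u ⁻¹ᵁ Y₀) (u ⁻¹ᵁ Y₁)).comp i =
      e.toAddMonoidHom.comp (cechDiff Y Y₀ Y₁) := by
    refine AddMonoidHom.ext fun s ↦ ?_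
    change resHom X _ ((u.app Y₀).hom s.1) + resHom X _ ((u.app Y₁).hom s.2) =
      (u.app (Y₀ ⊓ Y₁)).hom (resHom Y inf_le_left s.1 + resHom Y inf_le_right s.2)
    rw [map_add, app_resHom, app_resHom]
  have hker : Nat.card (cechDiff Y Y₀ Y₁).ker =
      Nat.card ((cechDiff X (u ⁻¹ᵁ Y₀) (u ⁻¹ᵁ Y₁)).comp i).ker := by
    rw [hcomm]
    congr 2
    ext s
    simp [AddMonoidHom.mem_ker]
  have hrange : (cechDiff Y Y₀ Y₁).range.index =
      ((cechDiff X (u ⁻¹ᵁ Y₀) (u ⁻¹ᵁ Y₁)).comp i).range.index := by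
    rw [hcomm, AddMonoidHom.range_comp]
    exact (AddSubgroup.index_map_equiv _ e).symm
  have key := AddMonoidHom.card_ker_mul_index_range_comp i hi (cechDiff X (u ⁻¹ᵁ Y₀) (u ⁻¹ᵁ Y₁))
  rw [← hker, ← hrange, hirange, ← card_H_zero_eq g h₀₁, ← card_H_one_eq g h₀ h₁ h₀₁,
    ← card_H_zero_eq f htop, ← card_H_one_eq f h₀' h₁' htop] at key
  have hq : 1 < Nat.card k := Finite.one_lt_card
  have : Finite (StructureCohomology g 0) := by
    have : Finite Γ(X, ⊤) := Finite.of_equiv _ (HZeroEquiv f).toEquiv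
    have hu : Function.Injective (u.app ⊤).hom := fun s t h ↦ by
      refine AbSheaf.ext_sup (F := structureSheafAb Y) (le_top : Y₀ ≤ ⊤) (le_top : Y₁ ≤ ⊤) h₀₁.ge
        (hinj ?_) (hbij.1 ?_)
      · exact (app_resHom u _ s).trans (.trans (by rw [h]) (app_resHom u _ t).symm)
      · exact (app_resHom u _ s).trans (.trans (by rw [h]) (app_resHom u _ t).symm)
    have : Finite Γ(Y, ⊤) := Finite.of_injective (β := Γ(X, ⊤)) _ hu
    exact Finite.of_equiv _ (HZeroEquiv g).toEquiv.symm
  have : Finite (StructureCohomology g 1) := by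
    -- Finiteness of `H¹` of `Y` comes for free: were it infinite, the left side of `key` would be
    -- `0`, while the right side is a product of nonzero factors.
    have h : Nat.card (StructureCohomology g 1) ≠ 0 := by
      intro h
      rw [h, mul_zero] at key
      have h1 : Nat.card (StructureCohomology g 0) ≠ 0 := Nat.card_pos.ne'
      have h2 : Nat.card (StructureCohomology f 1) ≠ 0 := Nat.card_pos.ne'
      have h3 : Nat.card k ^ y ≠ 0 := by positivity
      exact mul_ne_zero (mul_ne_zero h1 h3) h2 key.symm
    exact Nat.finite_of_card_ne_zero h
  have : Module.Finite k (StructureCohomology f 0) := Module.Finite.of_finite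
  have : Module.Finite k (StructureCohomology f 1) := Module.Finite.of_finite
  have : Module.Finite k (StructureCohomology g 0) := Module.Finite.of_finite
  have : Module.Finite k (StructureCohomology g 1) := Module.Finite.of_finite
  rw [Module.natCard_eq_pow_finrank (K := k) (V := StructureCohomology f 0),
    Module.natCard_eq_pow_finrank (K := k) (V := StructureCohomology f 1),
    Module.natCard_eq_pow_finrank (K := k) (V := StructureCohomology g 0),
    Module.natCard_eq_pow_finrank (K := k) (V := StructureCohomology g 1), ← pow_add, ← pow_add,
    ← pow_add] at key
  have := Nat.pow_right_injective hq key
  unfold arithmeticGenus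
  omega

end CurveGenus

-- Morphisms to `Proj` glued from two charts.

namespace CurveGenus

/-- Morphisms on two open subsets covering a scheme glue when they agree on the intersection. -/
theorem exists_glue_hom {X Z : Scheme.{u}} {U V : X.Opens} (hUV : U ⊔ V = ⊤)
    (φ : U.toScheme ⟶ Z) (ψ : V.toScheme ⟶ Z)
    (h : X.homOfLE (inf_le_left : U ⊓ V ≤ U) ≫ φ = X.homOfLE (inf_le_right : U ⊓ V ≤ V) ≫ ψ) :
    ∃ χ : X ⟶ Z, U.ι ≫ χ = φ ∧ V.ι ≫ χ = ψ := by
  let O : Bool → X.Opens := fun b ↦ bif b then U else V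
  have hO : IsOpenCover O := by rw [IsOpenCover, iSup_bool_eq]; exact hUV
  let 𝒰 := X.openCoverOfIsOpenCover O hO
  let χ : ∀ b, (O b).toScheme ⟶ Z
    | true => φ
    | false => ψ
  have hχ : ∀ b c, Limits.pullback.fst (𝒰.f b) (𝒰.f c) ≫ χ b = Limits.pullback.snd _ _ ≫ χ c := by
    intro (b : Bool) (c : Bool)
    have e := isPullback_opens_inf (O b) (O c)
    refine (cancel_epi e.isoPullback.hom).mp ?_
    change e.isoPullback.hom ≫ Limits.pullback.fst (O b).ι (O c).ι ≫ _ =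
      e.isoPullback.hom ≫ Limits.pullback.snd (O b).ι (O c).ι ≫ _
    rw [e.isoPullback_hom_fst_assoc, e.isoPullback_hom_snd_assoc]
    rcases b with _ | _ <;> rcases c with _ | _
    · rfl
    · have h' := congr(X.homOfLE (le_of_eq (inf_comm V U)) ≫ $h)
      rw [X.homOfLE_homOfLE_assoc, X.homOfLE_homOfLE_assoc] at h'
      exact h'.symm
    · exact h
    · rfl
  exact ⟨𝒰.glueMorphisms χ hχ, 𝒰.ι_glueMorphisms χ hχ true, 𝒰.ι_glueMorphisms χ hχ false⟩

theorem hom_ext_of_sup_eq_top {X Z : Scheme.{u}} {U V : X.Opens} (hUV : U ⊔ V = ⊤)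
    {φ ψ : X ⟶ Z} (h₁ : U.ι ≫ φ = U.ι ≫ ψ) (h₂ : V.ι ≫ φ = V.ι ≫ ψ) : φ = ψ := by
  refine Scheme.hom_ext_of_forall _ _ fun x ↦ ?_
  rcases (hUV ▸ trivial : x ∈ U ⊔ V) with h | h
  exacts [⟨U, h, h₁⟩, ⟨V, h, h₂⟩]

section Proj

open HomogeneousLocalization

variable {σ : Type*} {S : Type u} [CommRing S] [SetLike σ S] [AddSubgroupClass σ S]
  (𝒜 : ℕ → σ) [GradedRing 𝒜] {R : Type u} [CommRing R]

/-- The homomorphism on the degree zero part of `S[1/t]` given by a homomorphism on `S` which maps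
`t` to a unit. -/
def awayLift (ψ : S →+* R) {t : S} (ht : IsUnit (ψ t)) : Away 𝒜 t →+* R :=
  (IsLocalization.Away.lift t ht : Localization.Away t →+* R).comp
    (algebraMap (Away 𝒜 t) (Localization.Away t))

variable {𝒜} {d e : ℕ} {t s : S}

theorem awayLift_mk_mul (ψ : S →+* R) (ht : IsUnit (ψ t)) (hd : t ∈ 𝒜 d) (n : ℕ) (a : S)
    (ha : a ∈ 𝒜 (n • d)) : awayLift 𝒜 ψ ht (Away.mk 𝒜 hd n a ha) * ψ t ^ n = ψ a := by
  have h : (Away.mk 𝒜 hd n a ha).val * algebraMap S (Localization.Away t) t ^ n =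
      algebraMap S (Localization.Away t) a := by
    rw [Away.val_mk, ← map_pow, Localization.mk_eq_mk', 
      IsLocalization.mk'_spec (Localization.Away t) a (⟨t ^ n, n, rfl⟩ : Submonoid.powers t)]
  have := congrArg (IsLocalization.Away.lift t ht : Localization.Away t →+* R) h
  rwa [map_mul, map_pow, IsLocalization.Away.lift_eq, IsLocalization.Away.lift_eq] at this

theorem awayLift_mk_eq_iff (ψ : S →+* R) (ht : IsUnit (ψ t)) (hd : t ∈ 𝒜 d) (n : ℕ) (a : S)
    (ha : a ∈ 𝒜 (n • d)) (r : R) :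
    awayLift 𝒜 ψ ht (Away.mk 𝒜 hd n a ha) = r ↔ ψ a = r * ψ t ^ n := by
  rw [← awayLift_mk_mul ψ ht hd n a ha, (ht.pow n).mul_left_inj]

/-- The morphism to `Proj` given by a homomorphism on the homogeneous coordinate ring which maps a
homogeneous element of positive degree to a unit. -/
def toProj (ψ : S →+* R) (hd : t ∈ 𝒜 d) (hd0 : 0 < d) (ht : IsUnit (ψ t)) :
    Spec (.of R) ⟶ Proj 𝒜 :=
  Spec.map (CommRingCat.ofHom (awayLift 𝒜 ψ ht)) ≫ Proj.awayι 𝒜 t hd hd0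

theorem toProj_mul (ψ : S →+* R) (hd : t ∈ 𝒜 d) (hd0 : 0 < d) (ht : IsUnit (ψ t))
    (he : s ∈ 𝒜 e) (hts : IsUnit (ψ (t * s))) :
    toProj ψ hd hd0 ht = toProj ψ (SetLike.mul_mem_graded hd he) (Nat.add_pos_left hd0 e) hts := by
  rw [toProj, toProj, ← Proj.SpecMap_awayMap_awayι 𝒜 hd hd0 he rfl, ← Spec.map_comp_assoc,
    ← CommRingCat.ofHom_comp]
  congr 3
  refine RingHom.ext fun z ↦ ?_
  obtain ⟨n, a, ha, rfl⟩ := Away.mk_surjective 𝒜 hd z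
  have hs : IsUnit (ψ s) := isUnit_of_mul_isUnit_right (map_mul ψ t s ▸ hts)
  symm
  rw [RingHom.comp_apply, awayMap_mk, awayLift_mk_eq_iff, map_mul ψ a, map_mul ψ t, mul_pow,
    ← mul_assoc, awayLift_mk_mul, map_pow]

theorem toProj_congr {d' : ℕ} {t' : S} (ψ : S →+* R) (h : t = t') (h' : d = d') (hd : t ∈ 𝒜 d)
    (hd0 : 0 < d) (ht : IsUnit (ψ t)) :
    toProj ψ hd hd0 ht = toProj ψ (h ▸ h' ▸ hd) (h' ▸ hd0) (h ▸ ht) := by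
  subst h h'; rfl

/-- In a fraction of degree zero the powers of `r` cancel between numerator and denominator. -/
theorem toProj_eq_of_scale {ψ ψ' : S →+* R} (r : R) (h : ∀ n, ∀ a ∈ 𝒜 n, ψ' a = r ^ n * ψ a)
    (hd : t ∈ 𝒜 d) (hd0 : 0 < d) (ht : IsUnit (ψ t)) (ht' : IsUnit (ψ' t)) :
    toProj ψ hd hd0 ht = toProj ψ' hd hd0 ht' := by
  rw [toProj, toProj]
  congr 3
  refine RingHom.ext fun z ↦ ?_
  obtain ⟨n, a, ha, rfl⟩ := Away.mk_surjective 𝒜 hd z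
  have hr : IsUnit (r ^ d) := isUnit_of_mul_isUnit_left (h d t hd ▸ ht')
  rw [awayLift_mk_eq_iff, ← (hr.pow n).mul_right_inj]
  have h₁ := awayLift_mk_mul ψ' ht' hd n a ha
  rw [h _ _ ha, h _ _ hd, smul_eq_mul] at h₁
  rw [← pow_mul, mul_comm d n, ← h₁]
  ring

theorem SpecMap_toProj {R' : Type u} [CommRing R'] (χ : R →+* R') (ψ : S →+* R) (hd : t ∈ 𝒜 d)
    (hd0 : 0 < d) (ht : IsUnit (ψ t)) :
    Spec.map (CommRingCat.ofHom χ) ≫ toProj ψ hd hd0 ht =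
      toProj (χ.comp ψ) hd hd0 (ht.map χ) := by
  rw [toProj, toProj, ← Spec.map_comp_assoc, ← CommRingCat.ofHom_comp]
  congr 3
  refine RingHom.ext fun z ↦ ?_
  obtain ⟨n, a, ha, rfl⟩ := Away.mk_surjective 𝒜 hd z
  symm
  rw [awayLift_mk_eq_iff, RingHom.comp_apply, RingHom.comp_apply, RingHom.comp_apply, ← map_pow,
    ← map_mul, awayLift_mk_mul]

theorem toProj_toSpecZero (ψ : S →+* R) (hd : t ∈ 𝒜 d) (hd0 : 0 < d) (ht : IsUnit (ψ t)) :
    toProj ψ hd hd0 ht ≫ Proj.toSpecZero 𝒜 =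
      Spec.map (CommRingCat.ofHom (ψ.comp (algebraMap (𝒜 0) S))) := by
  rw [toProj, Category.assoc, Proj.awayι_toSpecZero, ← Spec.map_comp, ← CommRingCat.ofHom_comp]
  congr 2
  refine RingHom.ext fun z ↦ ?_
  have : fromZeroRingHom 𝒜 (.powers t) z = Away.mk 𝒜 hd 0 z.1 (by simp) := by
    ext; simp [fromZeroRingHom]; rfl
  rw [RingHom.comp_apply, this, awayLift_mk_eq_iff, pow_zero, mul_one]
  rfl

theorem toProj_preimage_basicOpen (ψ : S →+* R) (hd : t ∈ 𝒜 d) (hd0 : 0 < d) (ht : IsUnit (ψ t))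
    (he : s ∈ 𝒜 e) (he0 : 0 < e) :
    toProj ψ hd hd0 ht ⁻¹ᵁ Proj.basicOpen 𝒜 s = PrimeSpectrum.basicOpen (ψ s) := by
  rw [toProj, Scheme.Hom.comp_preimage, Proj.awayι_preimage_basicOpen 𝒜 hd hd0 he he0]
  have h := awayLift_mk_mul ψ ht hd e (s ^ d) (by
    simpa [mul_comm] using SetLike.pow_mem_graded d he)
  change PrimeSpectrum.basicOpen (awayLift 𝒜 ψ ht (Away.isLocalizationElem hd he)) = _
  have h2 := PrimeSpectrum.basicOpen_mul (awayLift 𝒜 ψ ht (Away.isLocalizationElem hd he)) (ψ t ^ e)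
  have h3 : PrimeSpectrum.basicOpen (ψ t ^ e) = ⊤ :=
    top_le_iff.mp fun x _ hx ↦ x.2.ne_top (Ideal.eq_top_of_isUnit_mem _ hx (ht.pow e))
  rw [h3, inf_top_eq] at h2
  rw [← h2]
  erw [h]
  rw [map_pow, PrimeSpectrum.basicOpen_pow _ _ hd0]

variable {X : Scheme.{u}} {U V : X.Opens}

theorem appLE_eq_awayLift (hU : IsAffineOpen U) (φ : X ⟶ Proj 𝒜) (ψ : S →+* Γ(X, U)) (hd : t ∈ 𝒜 d)
    (hd0 : 0 < d) (ht : IsUnit (ψ t)) (hφ : U.ι ≫ φ = U.toSpecΓ ≫ toProj ψ hd hd0 ht)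
    (hUt : U ≤ φ ⁻¹ᵁ Proj.basicOpen 𝒜 t) :
    Proj.awayToSection 𝒜 t ≫ φ.appLE (Proj.basicOpen 𝒜 t) U hUt =
      CommRingCat.ofHom (awayLift 𝒜 ψ ht) := by
  have : IsIso U.toSpecΓ := by rw [← hU.isoSpec_hom]; infer_instance
  apply Spec.map_injective
  rw [← cancel_epi U.toSpecΓ, Spec.map_comp, Scheme.Opens.toSpecΓ_SpecMap_appLE_assoc]
  change φ.resLE _ U hUt ≫ Proj.basicOpenToSpec 𝒜 t = _
  rw [← Proj.basicOpenIsoSpec_hom 𝒜 t hd hd0, ← Iso.eq_comp_inv, ← cancel_mono (Proj.basicOpen 𝒜 t).ι,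
    Category.assoc, Category.assoc, Proj.basicOpenIsoSpec_inv_ι, Scheme.Hom.resLE_comp_ι, hφ, toProj]

theorem inf_preimage_basicOpen (φ : X ⟶ Proj 𝒜) (ψ : S →+* Γ(X, U)) (hd : t ∈ 𝒜 d)
    (hd0 : 0 < d) (ht : IsUnit (ψ t)) (hφ : U.ι ≫ φ = U.toSpecΓ ≫ toProj ψ hd hd0 ht)
    (he : s ∈ 𝒜 e) (he0 : 0 < e) : U ⊓ φ ⁻¹ᵁ Proj.basicOpen 𝒜 s = X.basicOpen (ψ s) := by
  have h : U.ι ⁻¹ᵁ φ ⁻¹ᵁ Proj.basicOpen 𝒜 s = U.ι ⁻¹ᵁ X.basicOpen (ψ s) := by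
    rw [← Scheme.Hom.comp_preimage, hφ, Scheme.Hom.comp_preimage,
      toProj_preimage_basicOpen ψ hd hd0 ht he he0]
    exact Scheme.Opens.toSpecΓ_preimage_basicOpen U _
  have h2 := congrArg (U.ι ''ᵁ ·) h
  simp only [Scheme.Hom.image_preimage_eq_opensRange_inf, Scheme.Opens.opensRange_ι] at h2
  rw [h2, inf_eq_right]
  exact X.basicOpen_le _

/-- On `U ⊓ V` both morphisms land in the locus of `t * s`, where they are given by homomorphisms
differing by the scaling factor `r`, hence agree. -/
theorem exists_hom_proj (hUV : U ⊔ V = ⊤) (ψ : S →+* Γ(X, U)) (ψ' : S →+* Γ(X, V)) (hd : t ∈ 𝒜 d)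
    (hd0 : 0 < d) (ht : IsUnit (ψ t)) (he : s ∈ 𝒜 e) (he0 : 0 < e) (hs : IsUnit (ψ' s))
    (ht' : IsUnit (resHom X (inf_le_right : U ⊓ V ≤ V) (ψ' t)))
    (hs' : IsUnit (resHom X (inf_le_left : U ⊓ V ≤ U) (ψ s)))
    (r : Γ(X, U ⊓ V)) (h : ∀ n, ∀ a ∈ 𝒜 n, resHom X (inf_le_right : U ⊓ V ≤ V) (ψ' a) =
      r ^ n * resHom X (inf_le_left : U ⊓ V ≤ U) (ψ a)) :
    ∃ φ : X ⟶ Proj 𝒜, U.ι ≫ φ = U.toSpecΓ ≫ toProj ψ hd hd0 ht ∧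
      V.ι ≫ φ = V.toSpecΓ ≫ toProj ψ' he he0 hs := by
  refine exists_glue_hom hUV _ _ ?_
  rw [← Scheme.Opens.toSpecΓ_SpecMap_presheaf_map_assoc _ _ inf_le_left,
    ← Scheme.Opens.toSpecΓ_SpecMap_presheaf_map_assoc _ _ inf_le_right]
  congr 1
  refine (SpecMap_toProj (resHom X inf_le_left) ψ hd hd0 ht).trans
    (.trans ?_ (SpecMap_toProj (resHom X inf_le_right) ψ' he he0 hs).symm)
  let χ := (resHom X (inf_le_left : U ⊓ V ≤ U)).comp ψ
  let χ' := (resHom X (inf_le_right : U ⊓ V ≤ V)).comp ψ'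
  have hu : IsUnit (χ (t * s)) := (map_mul χ t s).symm ▸ (ht.map (resHom X inf_le_left)).mul hs'
  have hu' : IsUnit (χ' (t * s)) := (map_mul χ' t s).symm ▸ ht'.mul (hs.map (resHom X inf_le_right))
  refine (toProj_mul χ hd hd0 (ht.map (resHom X (inf_le_left : U ⊓ V ≤ U))) he hu).trans
    ((toProj_eq_of_scale (ψ' := χ') r h _ _ hu hu').trans ?_)
  rw [toProj_mul χ' he he0 (hs.map (resHom X (inf_le_right : U ⊓ V ≤ V))) hd (mul_comm t s ▸ hu')]
  exact toProj_congr χ' (mul_comm t s) (add_comm d e) _ _ _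

end Proj

end CurveGenus

-- Morphisms to projective space in coordinates.

namespace CurveGenus

section ToProjSpace

attribute [local instance] MvPolynomial.gradedAlgebra

open HomogeneousLocalization

variable {k : Type u} [Field k] {X : Scheme.{u}} {U V : X.Opens}

theorem toSpecΓ_SpecMap_scalarHom (f : X ⟶ Spec (.of k)) (U : X.Opens) :
    U.toSpecΓ ≫ Spec.map (CommRingCat.ofHom (scalarHom f U)) = U.ι ≫ f := by
  have h : CommRingCat.ofHom (scalarHom f U) = (Scheme.ΓSpecIso (CommRingCat.of k)).inv ≫
      f.appTop ≫ X.presheaf.map (homOfLE (le_top : U ≤ ⊤)).op := rfl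
  rw [h, Spec.map_comp, Spec.map_comp, Category.assoc,
    Scheme.Opens.toSpecΓ_SpecMap_presheaf_map_top_assoc, ← Scheme.toSpecΓ_naturality_assoc,
    toSpecΓ_SpecMap_ΓSpecIso_inv, Category.comp_id]

theorem resHom_scalarHom (f : X ⟶ Spec (.of k)) (h : V ≤ U) (c : k) :
    resHom X h (scalarHom f U c) = scalarHom f V c := map_scalarHom f (homOfLE h) c

theorem eval₂Hom_eq_pow_mul {σ R : Type*} [CommRing R] (χ : k →+* R) (s s' : σ → R) (r : R)
    (hs : ∀ i, s' i = r * s i) (n : ℕ) (a : MvPolynomial σ k)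
    (ha : a ∈ MvPolynomial.homogeneousSubmodule σ k n) :
    MvPolynomial.eval₂Hom χ s' a = r ^ n * MvPolynomial.eval₂Hom χ s a := by
  obtain rfl : s' = fun i ↦ r * s i := funext hs
  rw [MvPolynomial.mem_homogeneousSubmodule] at ha
  rw [MvPolynomial.coe_eval₂Hom, MvPolynomial.coe_eval₂Hom, MvPolynomial.eval₂_eq,
    MvPolynomial.eval₂_eq, Finset.mul_sum]
  refine Finset.sum_congr rfl fun d hd ↦ ?_
  have h := ha (MvPolynomial.mem_support_iff.mp hd)
  rw [← h, Finsupp.weight_apply, Finsupp.sum]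
  simp only [mul_pow, Finset.prod_mul_distrib, Finset.prod_pow_eq_pow_sum, Pi.one_apply, smul_eq_mul,
    mul_one]
  ring

/-- Dehomogenization: as `s i = 1`, a fraction `a / X_i^n` takes the same value as `a`, and `X_j /
X_i` takes the value `s j`. -/
theorem range_awayLift_eval₂Hom {R : Type u} [CommRing R] {M : ℕ} (χ : k →+* R)
    (s : Fin (M + 1) → R) (i : Fin (M + 1)) (hi : s i = 1)
    (hu : IsUnit (MvPolynomial.eval₂Hom χ s (MvPolynomial.X i))) :
    (awayLift (MvPolynomial.homogeneousSubmodule (Fin (M + 1)) k) (MvPolynomial.eval₂Hom χ s)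
      hu).range = (MvPolynomial.eval₂Hom χ s).range := by
  have hX : ∀ j, (MvPolynomial.X j : MvPolynomial (Fin (M + 1)) k) ∈
    MvPolynomial.homogeneousSubmodule (Fin (M + 1)) k 1 := fun j ↦ MvPolynomial.isHomogeneous_X k j
  have h1 : MvPolynomial.eval₂Hom χ s (MvPolynomial.X i) = 1 := by simp [hi]
  apply le_antisymm
  · rintro _ ⟨z, rfl⟩
    obtain ⟨n, a, ha, rfl⟩ := Away.mk_surjective _ (hX i) z
    refine ⟨a, ?_⟩
    rw [← awayLift_mk_mul _ hu (hX i) n a ha, h1, one_pow, mul_one]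
  · rintro _ ⟨p, rfl⟩
    induction p using MvPolynomial.induction_on with
    | C c =>
      refine ⟨Away.mk _ (hX i) 0 (MvPolynomial.C c) ?_, ?_⟩
      · simp
      · rw [awayLift_mk_eq_iff, pow_zero, mul_one]
    | add p q hp hq => rw [map_add]; exact add_mem hp hq
    | mul_X p j hp =>
      rw [map_mul]
      refine mul_mem hp ⟨Away.mk _ (hX i) 1 (MvPolynomial.X j) (by simpa using hX j), ?_⟩
      rw [awayLift_mk_eq_iff, h1, one_pow, mul_one]

/-- A morphism to projective space given by sections `sᵢ` on `U` and `s'ᵢ` on `V` with `s'ᵢ = h' sᵢ`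
on `U ∩ V`. -/
theorem exists_hom_projSpace (f : X ⟶ Spec (.of k)) (hU : IsAffineOpen U) (hV : IsAffineOpen V)
    (hUV : U ⊔ V = ⊤) {h : Γ(X, U)} {h' : Γ(X, V)} (hh : X.basicOpen h = U ⊓ V)
    (hh' : X.basicOpen h' = U ⊓ V) {M : ℕ} (s : Fin (M + 1) → Γ(X, U)) (s' : Fin (M + 1) → Γ(X, V))
    (hs : ∀ i, resHom X (inf_le_right : U ⊓ V ≤ V) (s' i) =
      resHom X (inf_le_right : U ⊓ V ≤ V) h' * resHom X (inf_le_left : U ⊓ V ≤ U) (s i))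
    {i j : Fin (M + 1)} (hi : s i = 1) (hi' : s' i = h') (hj : s j = h) (hj' : s' j = 1) :
    ∃ (φ : X ⟶ ProjSpace k M) (Y₀ Y₁ : (ProjSpace k M).Opens) (h₀ : U = φ ⁻¹ᵁ Y₀)
      (h₁ : V = φ ⁻¹ᵁ Y₁), φ ≫ ProjSpace.toSpec k M = f ∧ IsAffineOpen Y₀ ∧ IsAffineOpen Y₁ ∧
      (φ.appLE Y₀ U h₀.le).hom.range = (MvPolynomial.eval₂Hom (scalarHom f U) s).range ∧
      (φ.appLE Y₁ V h₁.le).hom.range = (MvPolynomial.eval₂Hom (scalarHom f V) s').range := by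
  let 𝒜 := MvPolynomial.homogeneousSubmodule (Fin (M + 1)) k
  have hX : ∀ j, (MvPolynomial.X j : MvPolynomial (Fin (M + 1)) k) ∈ 𝒜 1 :=
    fun j ↦ MvPolynomial.isHomogeneous_X k j
  let ψ := MvPolynomial.eval₂Hom (scalarHom f U) s
  let ψ' := MvPolynomial.eval₂Hom (scalarHom f V) s'
  have e₁ : ψ (.X i) = 1 := by simp [ψ, hi]
  have e₂ : ψ (.X j) = h := by simp [ψ, hj]
  have e₃ : ψ' (.X i) = h' := by simp [ψ', hi']
  have e₄ : ψ' (.X j) = 1 := by simp [ψ', hj']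
  have ui : IsUnit (ψ (.X i)) := e₁ ▸ isUnit_one
  have uj : IsUnit (ψ' (.X j)) := e₄ ▸ isUnit_one
  obtain ⟨φ, hφ, hφ'⟩ := exists_hom_proj (𝒜 := 𝒜) hUV ψ ψ' (hX i) one_pos ui (hX j) one_pos uj
    (e₃ ▸ isUnit_resHom_basicOpen _ hh'.ge) (e₂ ▸ isUnit_resHom_basicOpen _ hh.ge)
    (resHom X (inf_le_right : U ⊓ V ≤ V) h') fun n a ha ↦ by
      have e₅ : (resHom X (inf_le_right : U ⊓ V ≤ V)).comp ψ' = MvPolynomial.eval₂Hom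
          (scalarHom f (U ⊓ V)) fun i ↦ resHom X (inf_le_right : U ⊓ V ≤ V) (s' i) := by
        ext <;> simp [ψ', resHom_scalarHom]
      have e₆ : (resHom X (inf_le_left : U ⊓ V ≤ U)).comp ψ = MvPolynomial.eval₂Hom
          (scalarHom f (U ⊓ V)) fun i ↦ resHom X (inf_le_left : U ⊓ V ≤ U) (s i) := by
        ext <;> simp [ψ, resHom_scalarHom]
      rw [← RingHom.comp_apply, ← RingHom.comp_apply, e₅, e₆]
      exact eval₂Hom_eq_pow_mul _ _ _ _ hs n a ha
  have d₁ := inf_preimage_basicOpen φ ψ (hX i) one_pos ui hφ (hX i) one_pos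
  have d₂ := inf_preimage_basicOpen φ ψ (hX i) one_pos ui hφ (hX j) one_pos
  have d₃ := inf_preimage_basicOpen φ ψ' (hX j) one_pos uj hφ' (hX i) one_pos
  have d₄ := inf_preimage_basicOpen φ ψ' (hX j) one_pos uj hφ' (hX j) one_pos
  rw [e₁, Scheme.basicOpen_of_isUnit X isUnit_one] at d₁
  rw [e₂, hh] at d₂
  rw [e₃, hh'] at d₃
  rw [e₄, Scheme.basicOpen_of_isUnit X isUnit_one] at d₄
  -- The coordinate `X i` is `1` on `U` and `h'` on `V`, and `h'` is invertible only on `U ⊓ V`. The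
  -- coordinate `X j` plays the symmetric role.
  have h₀ : U = φ ⁻¹ᵁ Proj.basicOpen 𝒜 (.X i) := by
    refine le_antisymm (inf_eq_left.mp d₁) ?_
    rw [← top_inf_eq (φ ⁻¹ᵁ _), ← hUV, inf_sup_right, d₁, d₃]
    exact sup_le le_rfl inf_le_left
  have h₁ : V = φ ⁻¹ᵁ Proj.basicOpen 𝒜 (.X j) := by
    refine le_antisymm (inf_eq_left.mp d₄) ?_
    rw [← top_inf_eq (φ ⁻¹ᵁ _), ← hUV, inf_sup_right, d₂, d₄]
    exact sup_le inf_le_right le_rfl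
  have range_eq : ∀ {W : X.Opens} (hW : IsAffineOpen W) (χ : MvPolynomial (Fin (M + 1)) k →+* Γ(X, W))
      (l : Fin (M + 1)) (hl : IsUnit (χ (.X l))) (_ : W.ι ≫ φ = W.toSpecΓ ≫ toProj χ (hX l) one_pos hl)
      (hWl : W ≤ φ ⁻¹ᵁ Proj.basicOpen 𝒜 (.X l)),
      (φ.appLE (Proj.basicOpen 𝒜 (.X l)) W hWl).hom.range = (awayLift 𝒜 χ hl).range := by
    intro W hW χ l hl hφ hWl
    have h := congrArg CommRingCat.Hom.hom (appLE_eq_awayLift hW φ χ (hX l) one_pos hl hφ hWl)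
    have h2 : Function.Surjective (Proj.awayToSection 𝒜 (MvPolynomial.X l)).hom := by
      rw [← Proj.basicOpenIsoAway_hom 𝒜 (MvPolynomial.X l) (hX l) one_pos]
      exact (ConcreteCategory.bijective_of_isIso _).2
    rw [CommRingCat.hom_ofHom] at h
    rw [← h, CommRingCat.hom_comp, ← RingHom.map_range, RingHom.range_eq_top.mpr h2,
      RingHom.range_eq_map]
  refine ⟨φ, Proj.basicOpen 𝒜 (.X i), Proj.basicOpen 𝒜 (.X j), h₀, h₁, ?_,
    Proj.isAffineOpen_basicOpen _ _ (hX i) one_pos, Proj.isAffineOpen_basicOpen _ _ (hX j) one_pos,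
    (range_eq hU ψ i ui hφ _).trans (range_awayLift_eval₂Hom _ _ _ hi _),
    (range_eq hV ψ' j uj hφ' _).trans (range_awayLift_eval₂Hom _ _ _ hj' _)⟩
  have comp_eq : ∀ (W : X.Opens) (w : Fin (M + 1) → Γ(X, W))
      (l : Fin (M + 1)) (hl : IsUnit (MvPolynomial.eval₂Hom (scalarHom f W) w (.X l))),
      W.toSpecΓ ≫ toProj _ (hX l) one_pos hl ≫ ProjSpace.toSpec k M = W.ι ≫ f := by
    intro W w l hl
    rw [ProjSpace.toSpec]
    refine (congrArg (W.toSpecΓ ≫ ·) ((Category.assoc _ _ _).symm.trans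
      (congrArg (· ≫ _) (toProj_toSpecZero _ (hX l) one_pos hl)))).trans ?_
    rw [← Spec.map_comp, ← CommRingCat.ofHom_comp, ← toSpecΓ_SpecMap_scalarHom]
    congr 3
    ext c
    exact MvPolynomial.eval₂_C _ _ _
  apply hom_ext_of_sup_eq_top hUV
  · exact ((Category.assoc _ _ _).symm.trans (congrArg (· ≫ ProjSpace.toSpec k M) hφ)).trans
      ((Category.assoc _ _ _).trans (comp_eq U s i ui))
  · exact ((Category.assoc _ _ _).symm.trans (congrArg (· ≫ ProjSpace.toSpec k M) hφ')).trans
      ((Category.assoc _ _ _).trans (comp_eq V s' j uj))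

end ToProjSpace

end CurveGenus

-- Covering a projective curve by two affine charts.

namespace CurveGenus

/-- A proper closed subset of an irreducible Noetherian space of dimension at most one is finite and
consists of closed points. -/
theorem finite_of_isClosed_ne_univ {T : Type*} [TopologicalSpace T] [IrreducibleSpace T] [T0Space T]
    [NoetherianSpace T] (hT : topologicalKrullDim T ≤ 1) {Z : Set T} (hZ : IsClosed Z)
    (hZ' : Z ≠ Set.univ) : Z.Finite ∧ ∀ z ∈ Z, IsClosed {z} := by
  -- Otherwise `closure {z} < S < univ` is a chain of irreducible closed sets of length two.
  have key : ∀ S ⊆ Z, IsClosed S → IsIrreducible S → ∀ z ∈ S, closure {z} = S := by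
    intro S hSZ hS hS' z hz
    refine (hS.closure_subset_iff.mpr (Set.singleton_subset_iff.mpr hz)).eq_of_not_ssubset fun hlt ↦ ?_
    let a : IrreducibleCloseds T := ⟨closure {z}, isIrreducible_singleton.closure, isClosed_closure⟩
    let b : IrreducibleCloseds T := ⟨S, hS', hS⟩
    let c : IrreducibleCloseds T := ⟨Set.univ, IrreducibleSpace.isIrreducible_univ T, isClosed_univ⟩
    have hab : a < b := hlt
    have hbc : b < c := Set.ssubset_univ_iff.mpr fun h ↦ hZ' (Set.eq_univ_of_univ_subset (h ▸ hSZ))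
    have := Order.LTSeries.length_le_krullDim
      ({ length := 2, toFun := ![a, b, c], step := Fin.forall_fin_two.mpr ⟨hab, hbc⟩ } :
        LTSeries (IrreducibleCloseds T))
    have h2 := this.trans hT
    norm_cast at h2
  obtain ⟨S, hSf, hSc, hSi, hSU⟩ := NoetherianSpace.exists_finite_set_isClosed_irreducible hZ
  have hsub : ∀ t ∈ S, t ⊆ Z := fun t ht ↦ hSU ▸ Set.subset_sUnion_of_mem ht
  have hcl : ∀ z ∈ Z, ∃ t ∈ S, t = {z} := by
    intro z hz
    obtain ⟨t, ht, hzt⟩ := hSU ▸ hz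
    refine ⟨t, ht, Set.eq_singleton_iff_unique_mem.mpr ⟨hzt, fun w hw ↦ ?_⟩⟩
    refine (inseparable_iff_closure_eq.mpr ?_).eq
    rw [key t (hsub t ht) (hSc t ht) (hSi t ht) z hzt, key t (hsub t ht) (hSc t ht) (hSi t ht) w hw]
  refine ⟨?_, fun z hz ↦ ?_⟩
  · refine Set.Finite.of_finite_image (f := fun z ↦ ({z} : Set T)) (hSf.subset ?_)
      Set.singleton_injective.injOn
    rintro _ ⟨z, hz, rfl⟩
    obtain ⟨t, ht, h⟩ := hcl z hz
    exact (congrArg (· ∈ S) h).mp ht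
  · obtain ⟨t, ht, h⟩ := hcl z hz
    exact h ▸ hSc t ht

section Proj

open HomogeneousLocalization

variable {σ : Type*} {S : Type u} [CommRing S] [SetLike σ S] [AddSubgroupClass σ S]
  {𝒜 : ℕ → σ} [GradedRing 𝒜] {d e : ℕ} {f g : S}

theorem basicOpen_awayToSection (hf : f ∈ 𝒜 d) (hd : 0 < d) (hg : g ∈ 𝒜 e) (he : 0 < e) :
    (Proj 𝒜).basicOpen ((Proj.awayToSection 𝒜 f).hom (Away.isLocalizationElem hf hg)) =
      Proj.basicOpen 𝒜 f ⊓ Proj.basicOpen 𝒜 g := by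
  have h : (Proj.basicOpen 𝒜 f).ι ⁻¹ᵁ Proj.basicOpen 𝒜 g = (Proj.basicOpen 𝒜 f).ι ⁻¹ᵁ
      (Proj 𝒜).basicOpen ((Proj.awayToSection 𝒜 f).hom (Away.isLocalizationElem hf hg)) := by
    rw [← Scheme.Opens.toSpecΓ_preimage_basicOpen]
    have h2 := Proj.awayι_preimage_basicOpen 𝒜 hf hd hg he
    have h3 : (Proj.basicOpen 𝒜 f).ι = Proj.basicOpenToSpec 𝒜 f ≫ Proj.awayι 𝒜 f hf hd := by
      rw [← Proj.basicOpenIsoSpec_inv_ι, ← Proj.basicOpenIsoSpec_hom 𝒜 f hf hd, Iso.hom_inv_id_assoc]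
    conv_lhs => rw [h3]
    rw [Scheme.Hom.comp_preimage, h2]
    rfl
  have h2 := congrArg ((Proj.basicOpen 𝒜 f).ι ''ᵁ ·) h
  simp only [Scheme.Hom.image_preimage_eq_opensRange_inf, Scheme.Opens.opensRange_ι] at h2
  rw [h2, eq_comm, inf_eq_right]
  exact Scheme.basicOpen_le _ _

theorem awayMap_isLocalizationElem_mul (hf : f ∈ 𝒜 d) (hg : g ∈ 𝒜 e) :
    awayMap 𝒜 hg rfl (Away.isLocalizationElem hf hg) *
      awayMap 𝒜 hf (mul_comm f g) (Away.isLocalizationElem hg hf) = 1 := by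
  rw [awayMap_mk, awayMap_mk]
  apply HomogeneousLocalization.val_injective
  rw [val_mul, Away.val_mk, Away.val_mk, Localization.mk_mul, val_one, ← Localization.mk_one,
    Localization.mk_eq_mk_iff, Localization.r_iff_exists]
  refine ⟨1, ?_⟩
  simp only [Submonoid.coe_mul, Submonoid.coe_one]
  ring

/-- The sections `g ^ d / f ^ e` and `f ^ e / g ^ d`, for `f` and `g` homogeneous. -/
theorem exists_sections_proj (hf : f ∈ 𝒜 d) (hd : 0 < d) (hg : g ∈ 𝒜 e) (he : 0 < e) :
    ∃ (F : Γ(Proj 𝒜, Proj.basicOpen 𝒜 f)) (G : Γ(Proj 𝒜, Proj.basicOpen 𝒜 g)),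
      (Proj 𝒜).basicOpen F = Proj.basicOpen 𝒜 f ⊓ Proj.basicOpen 𝒜 g ∧
      (Proj 𝒜).basicOpen G = Proj.basicOpen 𝒜 f ⊓ Proj.basicOpen 𝒜 g ∧
      resHom (Proj 𝒜) (inf_le_left : Proj.basicOpen 𝒜 f ⊓ Proj.basicOpen 𝒜 g ≤ _) F *
        resHom (Proj 𝒜) (inf_le_right : Proj.basicOpen 𝒜 f ⊓ Proj.basicOpen 𝒜 g ≤ _) G = 1 := by
  refine ⟨_, _, basicOpen_awayToSection hf hd hg he, (basicOpen_awayToSection hg he hf hd).trans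
    (inf_comm _ _), ?_⟩
  have h : Proj.basicOpen 𝒜 f ⊓ Proj.basicOpen 𝒜 g = Proj.basicOpen 𝒜 (f * g) :=
    (Proj.basicOpen_mul _ _ _).symm
  have h₁ := ConcreteCategory.congr_hom (Proj.awayMap_awayToSection 𝒜 hg (f := f) rfl)
    (Away.isLocalizationElem hf hg)
  have h₂ := ConcreteCategory.congr_hom (Proj.awayMap_awayToSection 𝒜 hf (f := g) (mul_comm f g))
    (Away.isLocalizationElem hg hf)
  have h₃ := congrArg (resHom (Proj 𝒜) h.le) (congrArg (Proj.awayToSection 𝒜 (f * g)).hom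
    (awayMap_isLocalizationElem_mul hf hg))
  rw [map_mul, map_mul, map_one, map_one] at h₃
  refine Eq.trans (congrArg₂ (· * ·) ?_ ?_) h₃
  · refine Eq.trans ?_ (congrArg (resHom (Proj 𝒜) h.le) h₁.symm)
    exact (resHom_resHom _ _ _).symm
  · refine Eq.trans ?_ (congrArg (resHom (Proj 𝒜) h.le) h₂.symm)
    exact (resHom_resHom _ _ _).symm

/-- Every neighbourhood of a point contains one defined by a homogeneous element of positive
degree. -/
theorem exists_mem_proj_basicOpen_le {X : Scheme.{u}} (i : X ⟶ Proj 𝒜) [IsClosedImmersion i]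
    {O : X.Opens} {x : X} (hx : x ∈ O) :
    ∃ (d : ℕ) (f : S), 0 < d ∧ f ∈ 𝒜 d ∧ x ∈ i ⁻¹ᵁ Proj.basicOpen 𝒜 f ∧
      i ⁻¹ᵁ Proj.basicOpen 𝒜 f ≤ O := by
  obtain ⟨O', hO', hO⟩ := i.isClosedEmbedding.isInducing.isOpen_iff.mp O.2
  have hx' : i x ∈ (⟨O', hO'⟩ : (Proj 𝒜).Opens) := by
    change x ∈ i ⁻¹' O'
    rw [hO]; exact hx
  obtain ⟨_, ⟨_, ⟨f, rfl⟩, rfl⟩, hf, hfO⟩ :=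
    (Proj.isBasis_basicOpen 𝒜).exists_subset_of_mem_open hx' hO'
  rw [SetLike.mem_coe, Proj.basicOpen_eq_iSup_proj, Opens.mem_iSup] at hf
  obtain ⟨n, hn⟩ := hf
  -- The homogeneous component of `f` may have degree zero; multiplying by this `g` makes the degree
  -- positive.
  obtain ⟨m, g, hm, hg, hgx⟩ : ∃ (m : ℕ) (g : S), 0 < m ∧ g ∈ 𝒜 m ∧ i x ∈ Proj.basicOpen 𝒜 g := by
    have h := (i x).not_irrelevant_le
    contrapose! h
    intro a ha
    refine (Ideal.IsHomogeneous.mem_iff 𝒜 (HomogeneousIdeal.isHomogeneous _)).mpr fun m ↦ ?_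
    rcases Nat.eq_zero_or_pos m with rfl | hm
    · rw [show ((DirectSum.decompose 𝒜 a) 0 : S) = 0 from ha]; exact zero_mem _
    · exact not_not.mp (h m _ hm (SetLike.coe_mem _))
  refine ⟨n + m, GradedRing.proj 𝒜 n f * g, by lia, SetLike.mul_mem_graded (SetLike.coe_mem _) hg, ?_, ?_⟩
  · rw [Proj.basicOpen_mul]; exact ⟨hn, hgx⟩
  · intro z hz
    rw [Proj.basicOpen_mul] at hz
    have : i z ∈ Proj.basicOpen 𝒜 f := by
      rw [Proj.basicOpen_eq_iSup_proj, Opens.mem_iSup]; exact ⟨n, hz.1⟩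
    have h2 : z ∈ i ⁻¹' O' := hfO this
    rwa [hO] at h2

/-- A homogeneous element which vanishes at no point of a finite set of closed points. -/
theorem exists_finite_subset_proj_basicOpen {X : Scheme.{u}} (i : X ⟶ Proj 𝒜) [IsClosedImmersion i]
    {Z : Set X} (hZ : Z.Finite) (hZ' : ∀ z ∈ Z, IsClosed {z}) :
    ∃ (d : ℕ) (f : S), 0 < d ∧ f ∈ 𝒜 d ∧ Z ⊆ i ⁻¹ᵁ Proj.basicOpen 𝒜 f := by
  classical
  have h : ∀ z : Z, ∃ (d : ℕ) (f : S), 0 < d ∧ f ∈ 𝒜 d ∧ z.1 ∈ i ⁻¹ᵁ Proj.basicOpen 𝒜 f ∧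
      ∀ w ∈ Z, w ≠ z → w ∉ i ⁻¹ᵁ Proj.basicOpen 𝒜 f := by
    intro z
    have hc : IsClosed (Z \ {z.1}) := by
      rw [← Set.biUnion_of_singleton (Z \ {z.1})]
      exact (hZ.sdiff).isClosed_biUnion fun w hw ↦ hZ' w hw.1
    obtain ⟨d, f, hd, hf, hz, hO⟩ := exists_mem_proj_basicOpen_le (𝒜 := 𝒜) i
      (O := ⟨_, hc.isOpen_compl⟩) (x := z.1) (by simp)
    exact ⟨d, f, hd, hf, hz, fun w hw hwz h ↦ hO h ⟨hw, hwz⟩⟩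
  choose d f hd hf hz hw using h
  have := hZ.fintype
  -- The exponents bring all `f z` to the common degree `∏ z, d z`. At each point of `Z` exactly one
  -- summand is nonzero.
  refine ⟨∏ z, d z, ∑ z, f z ^ (∏ w ∈ Finset.univ.erase z, d w), Finset.prod_pos fun z _ ↦ hd z,
    sum_mem fun z _ ↦ ?_, fun z hzZ ↦ ?_⟩
  · have := SetLike.pow_mem_graded (∏ w ∈ Finset.univ.erase z, d w) (hf z)
    rwa [smul_eq_mul, Finset.prod_erase_mul _ _ (Finset.mem_univ z)] at this
  · intro hmem
    have hn : ∀ z, (∏ w ∈ Finset.univ.erase z, d w) ≠ 0 := fun z ↦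
      Finset.prod_ne_zero_iff.mpr fun w _ ↦ (hd w).ne'
    rw [← Finset.add_sum_erase _ _ (Finset.mem_univ (⟨z, hzZ⟩ : Z))] at hmem
    have hrest : ∑ w ∈ Finset.univ.erase ⟨z, hzZ⟩, f w ^ (∏ v ∈ Finset.univ.erase w, d v) ∈
        (i z).asHomogeneousIdeal := by
      refine sum_mem fun w hw' ↦ ?_
      refine Ideal.pow_mem_of_mem _ (not_not.mp (hw w z hzZ ?_)) _ (Nat.pos_of_ne_zero (hn w))
      rintro rfl
      simp at hw'
    have h3 := (Ideal.add_mem_iff_left _ hrest).mp hmem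
    exact hz ⟨z, hzZ⟩ ((i z).isPrime.mem_of_pow_mem _ h3)

/-- Choose `g` vanishing at `P` but not at the generic point, then `f` vanishing at none of the
finitely many zeros of `g`. The functions are `g^d / f^e` and its inverse. -/
theorem exists_charts_of_isClosedImmersion {A : Scheme.{u}} [IsIntegral A] [IsNoetherian A]
    (i : A ⟶ Proj 𝒜) [hi : IsClosedImmersion i] (hA : topologicalKrullDim A ≤ 1) {P : A}
    (hP : IsClosed {P}) (hne : genericPoint A ≠ P) :
    ∃ (U V : A.Opens) (h : Γ(A, U)) (h' : Γ(A, V)), IsAffineOpen U ∧ IsAffineOpen V ∧ U ⊔ V = ⊤ ∧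
      P ∈ U ∧ P ∉ V ∧ genericPoint A ∈ V ∧ A.basicOpen h = U ⊓ V ∧ A.basicOpen h' = U ⊓ V ∧
      resHom A (inf_le_left : U ⊓ V ≤ U) h * resHom A (inf_le_right : U ⊓ V ≤ V) h' = 1 := by
  obtain ⟨e, g, he, hg, hgη, hgO⟩ := exists_mem_proj_basicOpen_le (𝒜 := 𝒜) i
    (O := ⟨_, hP.isOpen_compl⟩) (x := genericPoint A) hne
  obtain ⟨hZ, hZ'⟩ := finite_of_isClosed_ne_univ hA
    (i ⁻¹ᵁ Proj.basicOpen 𝒜 g).2.isClosed_compl fun h ↦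
      (h ▸ trivial : genericPoint A ∈ ((i ⁻¹ᵁ Proj.basicOpen 𝒜 g : A.Opens) : Set A)ᶜ) hgη
  obtain ⟨d, f, hd, hf, hfZ⟩ := exists_finite_subset_proj_basicOpen (𝒜 := 𝒜) i hZ hZ'
  obtain ⟨F, G, hF, hG, hFG⟩ := exists_sections_proj hf hd hg he
  have hPg : P ∉ i ⁻¹ᵁ Proj.basicOpen 𝒜 g := fun h ↦ hgO h rfl
  refine ⟨i ⁻¹ᵁ Proj.basicOpen 𝒜 f, i ⁻¹ᵁ Proj.basicOpen 𝒜 g, (i.app _).hom F, (i.app _).hom G,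
    (Proj.isAffineOpen_basicOpen _ _ hf hd).preimage i,
    (Proj.isAffineOpen_basicOpen _ _ hg he).preimage i, ?_, hfZ hPg, hPg, hgη, ?_, ?_, ?_⟩
  · refine top_le_iff.mp fun x _ ↦ ?_
    by_cases hx : x ∈ i ⁻¹ᵁ Proj.basicOpen 𝒜 g
    exacts [Or.inr hx, Or.inl (hfZ hx)]
  · rw [← Scheme.preimage_basicOpen, hF]; rfl
  · rw [← Scheme.preimage_basicOpen, hG]; rfl
  · have := congrArg (i.app _).hom hFG
    rw [map_mul, map_one, app_resHom, app_resHom] at this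
    exact this

end Proj

section Curve

attribute [local instance] MvPolynomial.gradedAlgebra

variable {k : Type u} [Field k]

/-- The degree-zero part of the polynomial ring is `k`, so this is properness of `Proj` over its
degree-zero part, followed by an isomorphism. -/
instance (n : ℕ) : IsProper (ProjSpace.toSpec k n) := by
  have h : Function.Bijective
      (algebraMap k (MvPolynomial.homogeneousSubmodule (Fin (n + 1)) k 0)) := by
    constructor
    · intro c d h
      exact MvPolynomial.C_injective _ _ (congrArg Subtype.val h)
    · rintro ⟨p, hp⟩
      rw [MvPolynomial.mem_homogeneousSubmodule, ← MvPolynomial.totalDegree_zero_iff_isHomogeneous] at hp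
      refine ⟨p.coeff 0, Subtype.ext ?_⟩
      exact (MvPolynomial.totalDegree_eq_zero_iff_eq_C.mp hp).symm
  have : IsIso (CommRingCat.ofHom
      (algebraMap k (MvPolynomial.homogeneousSubmodule (Fin (n + 1)) k 0))) :=
    (ConcreteCategory.isIso_iff_bijective _).mpr h
  have : IsScalarTower k (MvPolynomial.homogeneousSubmodule (Fin (n + 1)) k 0)
    (MvPolynomial (Fin (n + 1)) k) :=
    IsScalarTower.of_algebraMap_eq (R := k) (S := MvPolynomial.homogeneousSubmodule (Fin (n + 1)) k 0)
      (A := MvPolynomial (Fin (n + 1)) k) fun _ ↦ rfl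
  have : Algebra.FiniteType (MvPolynomial.homogeneousSubmodule (Fin (n + 1)) k 0)
    (MvPolynomial (Fin (n + 1)) k) := .of_restrictScalars_finiteType k _ _
  have h₁ : IsProper (Proj.toSpecZero (MvPolynomial.homogeneousSubmodule (Fin (n + 1)) k)) :=
    inferInstance
  have h₂ : IsProper (Spec.map (CommRingCat.ofHom
      (algebraMap k (MvPolynomial.homogeneousSubmodule (Fin (n + 1)) k 0)))) := inferInstance
  exact MorphismProperty.comp_mem _ _ _ h₁ h₂

variable {A : Scheme.{u}} {a : A ⟶ Spec (.of k)}

theorem IsCurve.isProper (hA : IsCurve a) : IsProper a := by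
  obtain ⟨n, i, hi, rfl⟩ := hA.projective
  infer_instance

theorem IsCurve.isIntegral (hA : IsCurve a) : IsIntegral A :=
  have := hA.geometricallyIntegral
  GeometricallyIntegral.isIntegral_of_subsingleton a

theorem IsCurve.isNoetherian (hA : IsCurve a) : IsNoetherian A := by
  have := hA.isProper
  have : IsLocallyNoetherian A := LocallyOfFiniteType.isLocallyNoetherian a
  have : CompactSpace A := QuasiCompact.compactSpace_of_compactSpace a
  exact {}

theorem IsCurve.genericPoint_ne (hA : IsCurve a) [IrreducibleSpace A] {P : A} (hP : IsClosed {P}) :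
    genericPoint A ≠ P := by
  rintro rfl
  have h : ∀ x : A, x = genericPoint A := fun x ↦ by
    have := genericPoint_specializes x
    rwa [specializes_iff_mem_closure, hP.closure_eq] at this
  have : Subsingleton A := ⟨fun x y ↦ (h x).trans (h y).symm⟩
  have h2 := topologicalKrullDim_zero_of_discreteTopology A
  rw [hA.dim_eq_one] at h2
  norm_cast at h2

/-- A projective curve is covered by two affine open subsets, the complements of the zeros of two
mutually inverse functions; the zeros of the first contain a prescribed closed point. -/
theorem IsCurve.exists_charts (hA : IsCurve a) [IsIntegral A] {P : A} (hP : IsClosed {P}) :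
    ∃ (U V : A.Opens) (h : Γ(A, U)) (h' : Γ(A, V)), IsAffineOpen U ∧ IsAffineOpen V ∧ U ⊔ V = ⊤ ∧
      P ∈ U ∧ P ∉ V ∧ genericPoint A ∈ V ∧ A.basicOpen h = U ⊓ V ∧ A.basicOpen h' = U ⊓ V ∧
      resHom A (inf_le_left : U ⊓ V ≤ U) h * resHom A (inf_le_right : U ⊓ V ≤ V) h' = 1 := by
  have := hA.isNoetherian
  obtain ⟨n, i, hi, -⟩ := hA.projective
  exact exists_charts_of_isClosedImmersion
    (𝒜 := MvPolynomial.homogeneousSubmodule (Fin (n + 1)) k) (hi := hi) i hA.dim_eq_one.le hP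
    (hA.genericPoint_ne hP)

end Curve

end CurveGenus

-- Poles along the charts and finiteness of cohomology.

namespace CurveGenus

/-- Two affine open subsets `U` and `V` covering a scheme, with functions `h` on `U` and `h'` on `V`
inverse to each other on `U ∩ V`, which is the complement of the zeros of both. -/
structure Charts (X : Scheme.{u}) where
  U : X.Opens
  V : X.Opens
  h : Γ(X, U)
  h' : Γ(X, V)
  isAffineOpen_U : IsAffineOpen U
  isAffineOpen_V : IsAffineOpen V
  sup_eq_top : U ⊔ V = ⊤
  basicOpen_h : X.basicOpen h = U ⊓ V
  basicOpen_h' : X.basicOpen h' = U ⊓ V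
  mul_eq_one : resHom X (inf_le_left : U ⊓ V ≤ U) h * resHom X (inf_le_right : U ⊓ V ≤ V) h' = 1

namespace Charts

variable {X : Scheme.{u}} (c : Charts X)

/-- Restriction from the first chart to the intersection. -/
def resU : Γ(X, c.U) →+* Γ(X, c.U ⊓ c.V) := resHom X inf_le_left

/-- Restriction from the second chart to the intersection. -/
def resV : Γ(X, c.V) →+* Γ(X, c.U ⊓ c.V) := resHom X inf_le_right

theorem resU_mul_resV : c.resU c.h * c.resV c.h' = 1 := c.mul_eq_one

theorem resU_pow_mul_resV_pow (n : ℕ) : c.resU c.h ^ n * c.resV c.h' ^ n = 1 := by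
  rw [← mul_pow, resU_mul_resV, one_pow]

theorem exists_eq_pow_mul_resU (w : Γ(X, c.U ⊓ c.V)) :
    ∃ n b, w = c.resV c.h' ^ n * c.resU b := by
  obtain ⟨n, b, hb⟩ := exists_pow_mul_eq_resHom c.isAffineOpen_U c.h c.basicOpen_h.symm
    inf_le_left w
  refine ⟨n, b, ?_⟩
  change w * c.resU c.h ^ n = c.resU b at hb
  rw [← hb, mul_left_comm, mul_comm (_ ^ n), resU_pow_mul_resV_pow, mul_one]

theorem exists_eq_pow_mul_resV (w : Γ(X, c.U ⊓ c.V)) :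
    ∃ n b, w = c.resU c.h ^ n * c.resV b := by
  obtain ⟨n, b, hb⟩ := exists_pow_mul_eq_resHom c.isAffineOpen_V c.h' c.basicOpen_h'.symm
    inf_le_right w
  refine ⟨n, b, ?_⟩
  change w * c.resV c.h' ^ n = c.resV b at hb
  rw [← hb, mul_left_comm, resU_pow_mul_resV_pow, mul_one]

/-- On `V`, powers of `h'` clear the denominators of a function on `U ⊓ V`. Having every `n ≥ N`
allows one exponent to serve finitely many functions. -/
theorem exists_resV_pow_mul_resU (b : Γ(X, c.U)) :
    ∃ N, ∀ n ≥ N, ∃ t, c.resV c.h' ^ n * c.resU b = c.resV t := by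
  obtain ⟨N, t, h⟩ := c.exists_eq_pow_mul_resV (c.resU b)
  refine ⟨N, fun n hn ↦ ⟨c.h' ^ (n - N) * t, ?_⟩⟩
  rw [h, ← Nat.sub_add_cancel hn, pow_add, map_mul, map_pow, Nat.add_sub_cancel]
  linear_combination c.resV c.h' ^ (n - N) * c.resV t * c.resU_pow_mul_resV_pow N

theorem exists_resU_pow_mul_resV (b : Γ(X, c.V)) :
    ∃ N, ∀ n ≥ N, ∃ t, c.resU c.h ^ n * c.resV b = c.resU t := by
  obtain ⟨N, t, h⟩ := c.exists_eq_pow_mul_resU (c.resV b)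
  refine ⟨N, fun n hn ↦ ⟨c.h ^ (n - N) * t, ?_⟩⟩
  rw [h, ← Nat.sub_add_cancel hn, pow_add, map_mul, map_pow, Nat.add_sub_cancel]
  linear_combination c.resU c.h ^ (n - N) * c.resU t * c.resU_pow_mul_resV_pow N

/-- The charts with the functions replaced by powers. -/
@[simps]
def pow (N : ℕ) (hN : 0 < N) : Charts X where
  U := c.U
  V := c.V
  h := c.h ^ N
  h' := c.h' ^ N
  isAffineOpen_U := c.isAffineOpen_U
  isAffineOpen_V := c.isAffineOpen_V
  sup_eq_top := c.sup_eq_top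
  basicOpen_h := (X.basicOpen_pow _ hN).trans c.basicOpen_h
  basicOpen_h' := (X.basicOpen_pow _ hN).trans c.basicOpen_h'
  mul_eq_one := by
    rw [map_pow, map_pow]
    exact c.resU_pow_mul_resV_pow N

end Charts

section Finiteness

variable {k : Type u} [Field k] {X : Scheme.{u}} (f : X ⟶ Spec (.of k))

theorem finite_H_zero [Finite k] [IsIntegral X] [IsProper f] : Finite (StructureCohomology f 0) := by
  have h := finite_appTop_of_universallyClosed k f
  have : Finite Γ(Spec (.of k), ⊤) :=
    Finite.of_equiv k (Scheme.ΓSpecIso (.of k)).symm.commRingCatIsoToRingEquiv.toEquiv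
  let := f.appTop.hom.toAlgebra
  have : Module.Finite Γ(Spec (.of k), ⊤) Γ(X, ⊤) := h
  have : Finite Γ(X, ⊤) := Module.finite_of_finite Γ(Spec (.of k), ⊤)
  exact Finite.of_equiv _ (HZeroEquiv f).symm.toEquiv

/-- The sections on the first chart of a proper scheme are finite over the polynomials in `h`. -/
theorem exists_finite_generators (c : Charts X) [IsProper f] : ∃ (m : ℕ) (b : Fin m → Γ(X, c.U)),
    ∀ p : Γ(X, c.U) → Prop, (∀ x y, p x → p y → p (x + y)) → p 0 →
      (∀ j e n, p (scalarHom f c.U e * c.h ^ n * b j)) → ∀ x, p x := by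
  obtain ⟨φ, Y₀, -, h₀, -, hφ, hY₀, -, hr, -⟩ := exists_hom_projSpace f c.isAffineOpen_U
    c.isAffineOpen_V c.sup_eq_top c.basicOpen_h c.basicOpen_h' (M := 1) ![1, c.h] ![c.h', 1]
    (by
      rw [Fin.forall_fin_two]
      refine ⟨?_, ?_⟩
      · simp
      · simpa using ((mul_comm _ _).trans c.mul_eq_one).symm)
    (i := 0) (j := 1) rfl rfl rfl rfl
  have : IsProper (φ ≫ ProjSpace.toSpec k 1) := hφ ▸ ‹_›
  have : IsProper φ := .of_comp φ (ProjSpace.toSpec k 1)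
  have : IsAffine Y₀ := hY₀
  have : IsAffine (φ ⁻¹ᵁ Y₀) := h₀ ▸ c.isAffineOpen_U
  -- Over this chart the morphism `(1 : h)` to the projective line is proper and affine, hence
  -- finite; the image of the chart's coordinate ring is `k[h]`.
  have : IsFinite (φ ∣_ Y₀) := IsFinite.iff_isProper_and_isAffineHom.mpr ⟨inferInstance, inferInstance⟩
  have hfin := (φ ∣_ Y₀).finite_appTop
  have hfin' : (φ.appLE Y₀ c.U h₀.le).hom.Finite := by
    rw [Scheme.Hom.appTop, morphismRestrict_app'] at hfin
    exact (φ.appLE_congr _ (by simp) (by simp [h₀]) fun g ↦ g.hom.Finite).mp hfin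
  let := (φ.appLE Y₀ c.U h₀.le).hom.toAlgebra
  have : Module.Finite Γ(ProjSpace k 1, Y₀) Γ(X, c.U) := hfin'
  obtain ⟨m, b, hb⟩ := Module.Finite.exists_fin (R := Γ(ProjSpace k 1, Y₀)) (M := Γ(X, c.U))
  refine ⟨m, b, fun p hadd h0 hp x ↦ ?_⟩
  obtain ⟨r, rfl⟩ := (Submodule.mem_span_range_iff_exists_fun _).mp (hb ▸ Submodule.mem_top (x := x))
  refine Finset.sum_induction _ p hadd h0 fun j _ ↦ ?_
  obtain ⟨q, hq⟩ : (φ.appLE Y₀ c.U h₀.le).hom (r j) ∈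
    (MvPolynomial.eval₂Hom (scalarHom f c.U) ![1, c.h]).range := hr ▸ ⟨_, rfl⟩
  change p ((φ.appLE Y₀ c.U h₀.le).hom (r j) * b j)
  rw [← hq]
  clear hq
  induction q using MvPolynomial.induction_on' with
  | monomial d e =>
    rw [MvPolynomial.coe_eval₂Hom, MvPolynomial.eval₂_monomial, Finsupp.prod_fintype _ _ (by simp)]
    simpa using hp j e (d 1)
  | add q q' h h' => rw [map_add, add_mul]; exact hadd _ _ h h'

/-- Functions on `U ⊓ V` are sums of terms `e h'^n h^l b_j`. Such a term extends to `U` if `n ≤ l`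
and to `V` if `n - l` is large; the remaining ones span a finite-dimensional space. -/
theorem finite_H_one (c : Charts X) [Finite k] [IsProper f] : Finite (StructureCohomology f 1) := by
  obtain ⟨m, b, hb⟩ := exists_finite_generators f c
  let := (scalarHom f (c.U ⊓ c.V)).toAlgebra
  have hsmul : ∀ (e : k) (x : Γ(X, c.U ⊓ c.V)), e • x = scalarHom f _ e * x := fun _ _ ↦ rfl
  choose N hN using fun j ↦ c.exists_resV_pow_mul_resU (b j)
  let T : Set Γ(X, c.U ⊓ c.V) :=
    ⋃ j, (fun n ↦ c.resV c.h' ^ n * c.resU (b j)) '' Set.Iio (N j)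
  have hT : T.Finite := Set.finite_iUnion fun j ↦ (Set.finite_Iio _).image _
  have : Module.Finite k (Submodule.span k T) := Module.Finite.span_of_finite k hT
  have : Finite (Submodule.span k T) := Module.finite_of_finite k
  let H := (cechDiff X c.U c.V).range
  have hU : ∀ x, c.resU x ∈ H := fun x ↦ ⟨(x, 0), by
    change resHom X _ x + resHom X _ 0 = _; rw [map_zero, add_zero]; rfl⟩
  have hV : ∀ x, c.resV x ∈ H := fun x ↦ ⟨(0, x), by
    change resHom X _ 0 + resHom X _ x = _; rw [map_zero, zero_add]; rfl⟩
  have key : ∀ n x, c.resV c.h' ^ n * c.resU x ∈ H ⊔ (Submodule.span k T).toAddSubgroup := by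
    intro n
    refine hb _ (fun x y hx hy ↦ ?_) ?_ fun j e l ↦ ?_
    · rw [map_add, mul_add]; exact add_mem hx hy
    · rw [map_zero, mul_zero]; exact zero_mem _
    · rw [map_mul, map_mul, map_pow]
      rcases le_total n l with hnl | hnl
      · refine le_sup_left (a := H) ?_
        convert hU (scalarHom f _ e * c.h ^ (l - n) * b j) using 1
        rw [map_mul, map_mul, map_pow]
        nth_rw 1 [← Nat.sub_add_cancel hnl, pow_add]
        linear_combination c.resU (scalarHom f _ e) * c.resU c.h ^ (l - n) * c.resU (b j) *
          c.resU_pow_mul_resV_pow n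
      · have h1 : c.resV c.h' ^ n *
            (c.resU (scalarHom f _ e) * c.resU c.h ^ l * c.resU (b j)) =
            scalarHom f _ e * (c.resV c.h' ^ (n - l) * c.resU (b j)) := by
          have h2 : c.resU (scalarHom f _ e) = scalarHom f _ e := resHom_scalarHom f _ e
          rw [h2]
          nth_rw 1 [← Nat.sub_add_cancel hnl, pow_add]
          linear_combination scalarHom f _ e * c.resV c.h' ^ (n - l) * c.resU (b j) *
            c.resU_pow_mul_resV_pow l
        rw [h1]
        rcases lt_or_ge (n - l) (N j) with hlt | hge
        · refine le_sup_right (a := H) ?_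
          rw [← hsmul]
          exact Submodule.smul_mem _ _ (Submodule.subset_span (Set.mem_iUnion.mpr ⟨j, _, hlt, rfl⟩))
        · refine le_sup_left (a := H) ?_
          obtain ⟨t, ht⟩ := hN j _ hge
          rw [ht]
          convert hV (scalarHom f _ e * t) using 1
          rw [map_mul]
          exact congrArg (· * _) (resHom_scalarHom f _ e).symm
  have hfin : Finite (Γ(X, c.U ⊓ c.V) ⧸ H) := by
    refine Finite.of_surjective
      (fun x : Submodule.span k T ↦ (QuotientAddGroup.mk x.1 : Γ(X, c.U ⊓ c.V) ⧸ H)) fun w ↦ ?_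
    obtain ⟨w, rfl⟩ := QuotientAddGroup.mk_surjective w
    obtain ⟨n, x, rfl⟩ := c.exists_eq_pow_mul_resU w
    obtain ⟨y, hy, z, hz, h⟩ := AddSubgroup.mem_sup.mp (key n x)
    refine ⟨⟨z, hz⟩, ?_⟩
    rw [← h]
    exact QuotientAddGroup.eq.mpr (by simpa using hy)
  refine Nat.finite_of_card_ne_zero ?_
  rw [card_H_one_eq f c.isAffineOpen_U c.isAffineOpen_V c.sup_eq_top]
  exact AddSubgroup.index_ne_zero_iff_finite.mpr hfin

end Finiteness

end CurveGenus

-- The subring `k + I`: index and finite generation.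

namespace CurveGenus

section Subring

variable {k O B : Type*} [Field k] [CommRing O] [CommRing B]

/-- The subring `k + I`. -/
def scalarAddIdeal (χ : k →+* O) (I : Ideal O) : Subring O :=
  ((Ideal.Quotient.mk I).comp χ).range.comap (Ideal.Quotient.mk I)

theorem mem_scalarAddIdeal {χ : k →+* O} {I : Ideal O} {s : O} :
    s ∈ scalarAddIdeal χ I ↔ ∃ c, s - χ c ∈ I := by
  refine exists_congr fun c ↦ ?_
  rw [← Ideal.Quotient.eq, eq_comm]
  rfl

theorem coe_mem_scalarAddIdeal (χ : k →+* O) (I : Ideal O) (c : k) : χ c ∈ scalarAddIdeal χ I :=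
  mem_scalarAddIdeal.mpr ⟨c, by simp⟩

theorem mem_scalarAddIdeal_of_mem (χ : k →+* O) {I : Ideal O} {s : O} (hs : s ∈ I) :
    s ∈ scalarAddIdeal χ I :=
  mem_scalarAddIdeal.mpr ⟨0, by simpa⟩

/-- Since `B` surjects onto `O ⧸ I`, the index is that of the image of `k` in a ring with `q^(y+1)`
elements. -/
theorem index_comap_scalarAddIdeal [Finite k] (χ : k →+* O) {I : Ideal O} {y : ℕ}
    (hI : Nat.card (O ⧸ I) = Nat.card k ^ (y + 1)) (γ : B →+* O)
    (hγ : ∀ s, ∃ b, s - γ b ∈ I) :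
    ((scalarAddIdeal χ I).comap γ).toAddSubgroup.index = Nat.card k ^ y := by
  have hsurj : Function.Surjective ((Ideal.Quotient.mk I).comp γ) := fun s ↦ by
    obtain ⟨s, rfl⟩ := Ideal.Quotient.mk_surjective s
    obtain ⟨b, hb⟩ := hγ s
    exact ⟨b, (Ideal.Quotient.eq.mpr hb).symm⟩
  let H : AddSubgroup (O ⧸ I) := ((Ideal.Quotient.mk I).comp χ).toAddMonoidHom.range
  have h₀ : ((scalarAddIdeal χ I).comap γ).toAddSubgroup =
      H.comap ((Ideal.Quotient.mk I).comp γ).toAddMonoidHom := by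
    ext b
    rfl
  have h₁ : ((scalarAddIdeal χ I).comap γ).toAddSubgroup.index = H.index := by
    rw [h₀]
    exact AddSubgroup.index_comap_of_surjective H hsurj
  have hk : 1 < Nat.card k := Finite.one_lt_card
  have : Nontrivial (O ⧸ I) := by
    have h : 1 < Nat.card (O ⧸ I) := hI ▸ Nat.one_lt_pow y.succ_ne_zero hk
    have : Finite (O ⧸ I) := Nat.finite_of_card_ne_zero (Nat.ne_zero_of_lt h)
    exact Finite.one_lt_card_iff_nontrivial.mp h
  have h₂ : Nat.card H = Nat.card k :=
    (Nat.card_congr (Equiv.ofInjective _ ((Ideal.Quotient.mk I).comp χ).injective)).symm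
  have h₃ := H.index_mul_card
  rw [hI, h₂, pow_succ] at h₃
  rw [h₁]
  exact Nat.eq_of_mul_eq_mul_right (Nat.zero_lt_of_lt hk) h₃

/-- Units of a finite ring have finite order, so a power of `s` inverts `s` modulo `I`. This
replaces denominators by honest sections later on. -/
theorem exists_mul_pow_sub_one_mem {I : Ideal O} [Finite (O ⧸ I)] {s : O} (hs : IsUnit s) :
    ∃ n, s * s ^ n - 1 ∈ I := by
  obtain ⟨v, hv⟩ := hs.map (Ideal.Quotient.mk I)
  obtain ⟨n, hn, h⟩ := isOfFinOrder_iff_pow_eq_one.mp (isOfFinOrder_of_finite v)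
  refine ⟨n - 1, ?_⟩
  rw [← pow_succ', Nat.sub_add_cancel hn, ← Ideal.Quotient.eq, map_pow, ← hv, map_one, ← Units.val_one,
    ← h, Units.val_pow_eq_pow_val]

/-- Artin–Tate for a subring of finite index. -/
theorem exists_range_eval₂Hom_eq_of_index_ne_zero {k B : Type u} [Field k] [CommRing B] (χ : k →+* B)
    (hχ : χ.FiniteType) (R : Subring B) (hR : ∀ c, χ c ∈ R) (hidx : R.toAddSubgroup.index ≠ 0) :
    ∃ (m : ℕ) (b : Fin m → B), (MvPolynomial.eval₂Hom χ b).range = R := by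
  let := χ.toAlgebra
  let : Algebra k R := (χ.codRestrict R hR).toAlgebra
  have : IsScalarTower k R B := .of_algebraMap_eq fun _ ↦ rfl
  have hfin : Finite (B ⧸ R.toAddSubgroup) := AddSubgroup.index_ne_zero_iff_finite.mp hidx
  -- Over `R`, the ring `B` is generated by `1` and representatives of the finitely many cosets.
  have hspan : (⊤ : Submodule R B).FG := by
    refine Submodule.fg_def.mpr ⟨insert 1 (Set.range (Quotient.out : B ⧸ R.toAddSubgroup → B)),
      (Set.finite_range _).insert _, ?_⟩
    rw [eq_top_iff]
    intro x _
    have hx : -(QuotientAddGroup.mk x : B ⧸ R.toAddSubgroup).out + x ∈ R.toAddSubgroup :=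
      QuotientAddGroup.eq.mp (Quotient.out_eq _)
    have h : x = (QuotientAddGroup.mk x : B ⧸ R.toAddSubgroup).out +
        (⟨_, hx⟩ : R) • (1 : B) := by
      rw [Subring.smul_def, smul_eq_mul, mul_one]
      exact (add_neg_cancel_left _ _).symm
    rw [h]
    exact add_mem (Submodule.subset_span (.inr ⟨_, rfl⟩))
      (Submodule.smul_mem _ _ (Submodule.subset_span (.inl rfl)))
  have hfg : (⊤ : Subalgebra k R).FG :=
    fg_of_fg_of_fg k R B (Algebra.FiniteType.out (R := k) (A := B) (self := hχ)) hspan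
      Subtype.val_injective
  obtain ⟨m, φ, hφ⟩ := Algebra.FiniteType.iff_quotient_mvPolynomial''.mp ⟨hfg⟩
  refine ⟨m, fun i ↦ φ (.X i), ?_⟩
  have h : MvPolynomial.eval₂Hom χ (fun i ↦ (φ (.X i) : B)) = R.subtype.comp φ.toRingHom := by
    ext i
    · simp only [RingHom.comp_apply, MvPolynomial.coe_eval₂Hom, MvPolynomial.eval₂_C]
      exact (congrArg Subtype.val (φ.commutes _)).symm
    · simp
  rw [h]
  ext x
  constructor
  · rintro ⟨z, rfl⟩; exact (φ z).2
  · intro hx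
    obtain ⟨z, hz⟩ := hφ ⟨x, hx⟩
    exact ⟨z, congrArg Subtype.val hz⟩

theorem range_eval₂Hom_le {σ : Type*} {χ : k →+* B} {s : σ → B} {R : Subring B} (hχ : ∀ c, χ c ∈ R)
    (hs : ∀ i, s i ∈ R) : (MvPolynomial.eval₂Hom χ s).range ≤ R := by
  rintro _ ⟨p, rfl⟩
  induction p using MvPolynomial.induction_on with
  | C c => simpa using hχ c
  | add p q hp hq => rw [map_add]; exact add_mem hp hq
  | mul_X p i hp => rw [map_mul]; exact mul_mem hp (by simpa using hs i)

/-- In dimension at most one regularity makes the maximal ideal principal, so `O` is a discrete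
valuation ring and the successive quotients of powers of the maximal ideal are copies of the residue
field `k`. -/
theorem card_quotient_maximalIdeal_pow {k O : Type*} [Field k] [CommRing O] [IsDomain O]
    [IsRegularLocalRing O] (hdim : ringKrullDim O ≤ 1) (hO : ¬ IsField O) (χ : k →+* O)
    (hχ : ∀ s, ∃ c, s - χ c ∈ IsLocalRing.maximalIdeal O) (n : ℕ) :
    Nat.card (O ⧸ IsLocalRing.maximalIdeal O ^ n) = Nat.card k ^ n := by
  have hp : (IsLocalRing.maximalIdeal O).IsPrincipal := by
    have h := IsRegularLocalRing.spanFinrank_maximalIdeal (R := O) ▸ hdim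
    have h₁ : (IsLocalRing.maximalIdeal O).spanFinrank ≤ 1 := by exact_mod_cast h
    rcases Nat.le_one_iff_eq_zero_or_eq_one.mp h₁ with h₀ | h₁
    · rw [(Submodule.spanFinrank_eq_zero_iff_eq_bot (IsNoetherian.noetherian _)).mp h₀]
      infer_instance
    · exact ((Submodule.spanFinrank_eq_one_iff _).mp h₁).1
  have : IsDiscreteValuationRing O := ((IsDiscreteValuationRing.TFAE O hO).out 4 0).mp hp
  have h := cardQuot_pow_of_prime (P := IsLocalRing.maximalIdeal O)
    (IsDiscreteValuationRing.not_a_field O) (i := n)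
  rw [Submodule.cardQuot_apply, Submodule.cardQuot_apply] at h
  rw [h]
  congr 1
  refine (Nat.card_congr (Equiv.ofBijective
    ((Ideal.Quotient.mk (IsLocalRing.maximalIdeal O)).comp χ) ⟨RingHom.injective _, fun s ↦ ?_⟩)).symm
  obtain ⟨s, rfl⟩ := Ideal.Quotient.mk_surjective s
  obtain ⟨c, hc⟩ := hχ s
  exact ⟨c, (Ideal.Quotient.eq.mpr hc).symm⟩

end Subring

end CurveGenus

-- The local ring at a rational point.

namespace CurveGenus

section Stalk

variable {k : Type u} [Field k] {A : Scheme.{u}}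

/-- The germ at a point, as a ring homomorphism. -/
def germHom (A : Scheme.{u}) {U : A.Opens} {P : A} (hP : P ∈ U) : Γ(A, U) →+* A.presheaf.stalk P :=
  (A.presheaf.germ U P hP).hom

theorem germHom_resHom {U V : A.Opens} (h : V ≤ U) {P : A} (hP : P ∈ V) (s : Γ(A, U)) :
    germHom A hP (resHom A h s) = germHom A (h hP) s :=
  A.presheaf.germ_res_apply (homOfLE h) P hP s

theorem germHom_scalarHom (a : A ⟶ Spec (.of k)) {U : A.Opens} {P : A} (hP : P ∈ U) (c : k) :
    germHom A hP (scalarHom a U c) = stalkScalarHom a P c := by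
  rw [← resHom_scalarHom a (le_top : U ≤ ⊤), germHom_resHom]
  rfl

theorem isUnit_germHom_iff {U : A.Opens} {P : A} (hP : P ∈ U) (s : Γ(A, U)) :
    IsUnit (germHom A hP s) ↔ P ∈ A.basicOpen s :=
  (A.mem_basicOpen s P hP).symm

theorem exists_mul_germHom_eq {U : A.Opens} (hU : IsAffineOpen U) {P : A} (hP : P ∈ U)
    (s : A.presheaf.stalk P) : ∃ d b : Γ(A, U), IsUnit (germHom A hP d) ∧
      s * germHom A hP d = germHom A hP b := by
  have := hU.isLocalization_stalk ⟨P, hP⟩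
  let := TopCat.Presheaf.algebra_section_stalk A.presheaf (⟨P, hP⟩ : U)
  obtain ⟨⟨b, d⟩, h⟩ := IsLocalization.surj (hU.primeIdealOf ⟨P, hP⟩).asIdeal.primeCompl s
  exact ⟨d, b, IsLocalization.map_units (M := (hU.primeIdealOf ⟨P, hP⟩).asIdeal.primeCompl)
    (A.presheaf.stalk P) d, h⟩

/-- Write `s = b / d`; modulo `I` the inverse of `d` is a power `d^n`, so `b d^n` approximates `s`.
-/
theorem exists_sub_germHom_mem {U : A.Opens} (hU : IsAffineOpen U) {P : A} (hP : P ∈ U)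
    (I : Ideal (A.presheaf.stalk P)) [Finite (A.presheaf.stalk P ⧸ I)] (s : A.presheaf.stalk P) :
    ∃ b : Γ(A, U), s - germHom A hP b ∈ I := by
  obtain ⟨d, b, hd, h⟩ := exists_mul_germHom_eq hU hP s
  obtain ⟨n, hn⟩ := exists_mul_pow_sub_one_mem (I := I) hd
  refine ⟨b * d ^ n, ?_⟩
  have e : s - germHom A hP (b * d ^ n) =
      -s * (germHom A hP d * germHom A hP d ^ n - 1) := by
    rw [map_mul, map_pow, ← h]; ring
  rw [e]
  exact I.mul_mem_left _ hn

theorem ringKrullDim_stalk_le (P : A) : ringKrullDim (A.presheaf.stalk P) ≤ topologicalKrullDim A := by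
  rw [← PrimeSpectrum.topologicalKrullDim_eq_ringKrullDim]
  exact (A.fromSpecStalk P).isEmbedding.isInducing.topologicalKrullDim_le

theorem not_isField_stalk [IsIntegral A] {U : A.Opens} {P : A} (hP : P ∈ U) {h : Γ(A, U)}
    (h₀ : A.basicOpen h ≠ ⊥) (hh : P ∉ A.basicOpen h) : ¬ IsField (A.presheaf.stalk P) := by
  intro H
  rw [← isUnit_germHom_iff hP] at hh
  have h0 : germHom A hP h ≠ 0 := by
    intro e
    have : Nonempty U := ⟨⟨P, hP⟩⟩
    have := germ_injective_of_isIntegral A P hP (e.trans (map_zero _).symm)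
    rw [this] at h₀
    exact h₀ (A.basicOpen_zero _)
  let := H.toField
  exact hh h0.isUnit

theorem isClosed_singleton_of_section (a : A ⟶ Spec (.of k)) [IsSeparated a]
    (p : Spec (.of k) ⟶ A) (hp : p ≫ a = 𝟙 (Spec (.of k))) :
    IsClosed {p (IsLocalRing.closedPoint k)} := by
  have : IsClosedImmersion (p ≫ a) := hp ▸ inferInstance
  have : IsClosedImmersion p := .of_comp p a
  have h := p.isClosedEmbedding.isClosed_range
  have : Subsingleton (Spec (.of k)) := inferInstanceAs (Subsingleton (PrimeSpectrum k))
  rwa [Set.range_eq_singleton (y := p (IsLocalRing.closedPoint k))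
    fun x ↦ congrArg p (Subsingleton.elim x _)] at h

/-- The section `p` induces a retraction `ρ` of the local ring onto `k`. The difference of `s` and
the scalar `ρ s` is killed by `ρ`, hence is not a unit. -/
theorem exists_sub_stalkScalarHom_mem (a : A ⟶ Spec (.of k))
    (p : Spec (.of k) ⟶ A) (hp : p ≫ a = 𝟙 (Spec (.of k)))
    (s : A.presheaf.stalk (p (IsLocalRing.closedPoint k))) :
    ∃ c, s - stalkScalarHom a _ c ∈ IsLocalRing.maximalIdeal _ := by
  let ρ := (Scheme.stalkClosedPointTo p).hom
  have hρ : ∀ c, ρ (stalkScalarHom a _ c) = c := by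
    have h₁ := Scheme.germ_stalkClosedPointTo p ⊤ trivial
    have h₂ : (Scheme.ΓSpecIso (.of k)).inv ≫ a.appTop ≫ p.appTop ≫ (Scheme.ΓSpecIso (.of k)).hom =
        𝟙 _ := by
      rw [← Scheme.Hom.comp_appTop_assoc, hp, Scheme.Hom.id_appTop, Category.id_comp,
        Iso.inv_hom_id]
    have h₃ : CommRingCat.ofHom (stalkScalarHom a (p (IsLocalRing.closedPoint k))) =
        (Scheme.ΓSpecIso (.of k)).inv ≫ a.appTop ≫ A.presheaf.germ ⊤ _ trivial := by
      have : A.presheaf.map (homOfLE (le_top : (⊤ : A.Opens) ≤ ⊤)).op = 𝟙 _ := A.presheaf.map_id _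
      have h : CommRingCat.ofHom (stalkScalarHom a (p (IsLocalRing.closedPoint k))) =
        ((Scheme.ΓSpecIso (.of k)).inv ≫ a.appTop ≫
          A.presheaf.map (homOfLE (le_top : (⊤ : A.Opens) ≤ ⊤)).op) ≫
            A.presheaf.germ ⊤ _ trivial := rfl
      rw [h, this, Category.comp_id, Category.assoc]
    have h₄ : CommRingCat.ofHom (stalkScalarHom a (p (IsLocalRing.closedPoint k))) ≫
        Scheme.stalkClosedPointTo p = 𝟙 _ := by
      rw [h₃, Category.assoc, Category.assoc, h₁, ← h₂, Iso.trans_hom]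
      congr 3
    have h₅ := congrArg CommRingCat.Hom.hom h₄
    rw [CommRingCat.hom_comp, CommRingCat.hom_ofHom, CommRingCat.hom_id] at h₅
    exact fun c ↦ RingHom.congr_fun h₅ c
  refine ⟨ρ s, fun hu ↦ ?_⟩
  have := hu.map ρ
  rw [map_sub, hρ, sub_self] at this
  exact not_isUnit_zero this

end Stalk

end CurveGenus

-- Realizing a prescribed subring by projective coordinates.

namespace CurveGenus

section

variable {k : Type u} [Field k] {A : Scheme.{u}} (a : A ⟶ Spec (.of k))

theorem finiteType_scalarHom [LocallyOfFiniteType a] {U : A.Opens} (hU : IsAffineOpen U) :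
    (scalarHom a U).FiniteType := by
  have h := a.finiteType_appLE (isAffineOpen_top _) hU le_top
  have h₂ : scalarHom a U = (a.appLE ⊤ U le_top).hom.comp (Scheme.ΓSpecIso (.of k)).inv.hom := rfl
  rw [h₂]
  exact h.comp (.of_surjective _ (ConcreteCategory.bijective_of_isIso _).2)

/-- A morphism to projective space whose image has coordinate rings a prescribed subring on the first
chart and the full ring of sections on the second. -/
theorem exists_hom_projSpace_of_subring [LocallyOfFiniteType a] (c : Charts A)
    {R : Subring Γ(A, c.U)} {m : ℕ} (b : Fin m → Γ(A, c.U))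
    (hb : (MvPolynomial.eval₂Hom (scalarHom a c.U) b).range = R) (n₀ : ℕ)
    (hR : ∀ x, c.h ^ n₀ * x ∈ R) :
    ∃ (M : ℕ) (φ : A ⟶ ProjSpace k M) (Y₀ Y₁ : (ProjSpace k M).Opens) (h₀ : c.U = φ ⁻¹ᵁ Y₀)
      (h₁ : c.V = φ ⁻¹ᵁ Y₁), φ ≫ ProjSpace.toSpec k M = a ∧ IsAffineOpen Y₀ ∧ IsAffineOpen Y₁ ∧
      (φ.appLE Y₀ c.U h₀.le).hom.range = R ∧ (φ.appLE Y₁ c.V h₁.le).hom.range = ⊤ := by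
  obtain ⟨l, d, hd⟩ := exists_range_eval₂Hom_eq_of_index_ne_zero (scalarHom a c.V)
    (finiteType_scalarHom a c.isAffineOpen_V) ⊤ (fun _ ↦ trivial)
    (by
      have : (⊤ : Subring Γ(A, c.V)).toAddSubgroup = ⊤ := rfl
      rw [this, AddSubgroup.index_top]; exact one_ne_zero)
  choose N₁ hN₁ using fun i ↦ c.exists_resV_pow_mul_resU (b i)
  choose N₂ hN₂ using fun j ↦ c.exists_resU_pow_mul_resV (d j)
  -- Large enough that every `h'^N b_i` extends to `V` and every `h^(N - n₀) d_j` extends to `U`.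
  -- The spare factor `h^n₀` moves the extensions `e_j` into `R`; the final `1` makes `N` positive.
  let N := n₀ + ∑ i, N₁ i + ∑ j, N₂ j + 1
  have hN₁' : ∀ i, N₁ i ≤ N := fun i ↦
    (Finset.single_le_sum (fun _ _ ↦ Nat.zero_le _) (Finset.mem_univ i)).trans (by lia)
  have hN₂' : ∀ j, N₂ j ≤ N - n₀ := fun j ↦
    (Finset.single_le_sum (fun _ _ ↦ Nat.zero_le _) (Finset.mem_univ j)).trans (by lia)
  have hN0 : n₀ + (N - n₀) = N := by lia
  choose t ht using fun i ↦ hN₁ i N (hN₁' i)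
  choose e he using fun j ↦ hN₂ j (N - n₀) (hN₂' j)
  let c' := c.pow N (Nat.succ_pos _)
  let s : Fin (m + l + 1 + 1) → Γ(A, c.U) :=
    Fin.cons 1 (Fin.cons (c.h ^ N) (Fin.append b fun j ↦ c.h ^ n₀ * e j))
  let s' : Fin (m + l + 1 + 1) → Γ(A, c.V) :=
    Fin.cons (c.h' ^ N) (Fin.cons 1 (Fin.append t d))
  have hs : ∀ i, c.resV (s' i) = c.resV (c.h' ^ N) * c.resU (s i) := by
    refine Fin.cases ?_ (Fin.cases ?_ (Fin.addCases (fun i ↦ ?_) fun j ↦ ?_))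
    · simp [s, s']
    · simpa [s, s', mul_comm] using (c.resU_pow_mul_resV_pow N).symm
    · simpa [s, s'] using (ht i).symm
    · simp only [s, s', Fin.cons_succ, Fin.append_right, map_mul, map_pow]
      rw [← he, ← mul_assoc (c.resU c.h ^ n₀), ← pow_add, hN0]
      linear_combination -(c.resV (d j)) * c.resU_pow_mul_resV_pow N
  obtain ⟨φ, Y₀, Y₁, h₀, h₁, hφ, hY₀, hY₁, hr₀, hr₁⟩ := exists_hom_projSpace a
    c.isAffineOpen_U c.isAffineOpen_V c.sup_eq_top (h := c.h ^ N) (h' := c.h' ^ N) c'.basicOpen_h c'.basicOpen_h' s s' hs (i := 0) (j := 1)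
    rfl rfl rfl rfl
  refine ⟨_, φ, Y₀, Y₁, h₀, h₁, hφ, hY₀, hY₁, hr₀.trans (le_antisymm ?_ ?_), hr₁.trans (top_le_iff.mp ?_)⟩
  · have hχ : ∀ x, scalarHom a c.U x ∈ R := fun x ↦ hb ▸ ⟨.C x, by simp⟩
    refine range_eval₂Hom_le hχ (Fin.cases (one_mem R) (Fin.cases ?_ (Fin.addCases (fun i ↦ ?_)
      fun j ↦ ?_)))
    · have := hR (c.h ^ (N - n₀))
      rwa [← pow_add, hN0] at this
    · exact hb ▸ ⟨.X i, by simp [s]⟩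
    · simpa [s] using hR (e j)
  · rw [← hb]
    exact range_eval₂Hom_le (fun x ↦ ⟨.C x, by simp⟩)
      fun i ↦ ⟨.X (Fin.castAdd l i).succ.succ, by simp [s]⟩
  · rw [← hd]
    exact range_eval₂Hom_le (fun x ↦ ⟨.C x, by simp⟩)
      fun j ↦ ⟨.X (Fin.natAdd m j).succ.succ, by simp [s']⟩

end

end CurveGenus

-- Geometry of the morphism `u` and its conductor.

namespace CurveGenus

variable {A Y : Scheme.{u}}

/-- Base change to a field is flat here, so it preserves scheme-theoretic dominance, which transfers
reducedness to the target; surjectivity transfers irreducibility. -/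
theorem geometricallyIntegral_of_surjective {S : Scheme.{u}} [Subsingleton S] [IsIntegral S]
    (u : A ⟶ Y) (b : Y ⟶ S) [IsSchemeTheoreticallyDominant u] [QuasiCompact u] [Surjective u]
    [GeometricallyIntegral (u ≫ b)] : GeometricallyIntegral b := by
  refine ⟨fun K _ y Z fst snd H ↦ ?_⟩
  have : Flat y := inferInstance
  have : Flat fst := MorphismProperty.of_isPullback H.flip ‹Flat y›
  have H' := IsPullback.of_hasPullback u fst
  have hint : IsIntegral (Limits.pullback u fst) :=
    GeometricallyIntegral.geometrically_isIntegral (f := u ≫ b) y _ _ (H'.paste_vert H)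
  have : IsReduced Z := IsSchemeTheoreticallyDominant.isReduced (Limits.pullback.snd u fst)
  have : IrreducibleSpace Z := by
    have hs := (Limits.pullback.snd u fst).surjective
    have : Nonempty Z := ⟨Limits.pullback.snd u fst (Nonempty.some inferInstance)⟩
    have h := (PreirreducibleSpace.isPreirreducible_univ
      (X := (Limits.pullback u fst : Scheme.{u}))).image (Limits.pullback.snd u fst)
      (Limits.pullback.snd u fst).continuous.continuousOn
    rw [Set.image_univ, hs.range_eq] at h
    exact { isPreirreducible_univ := h, toNonempty := ‹_› }
  exact isIntegral_of_irreducibleSpace_of_isReduced Z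

theorem isIso_app_of_le (u : A ⟶ Y) {V W : Y.Opens} [IsIso (u ∣_ V)] (h : W ≤ V) :
    IsIso (u.app W) := by
  have h₁ : IsIso ((u ∣_ V).app (V.ι ⁻¹ᵁ W)) := inferInstance
  have h₂ : V.ι ''ᵁ V.ι ⁻¹ᵁ W = W := by
    rw [Scheme.Hom.image_preimage_eq_opensRange_inf, Scheme.Opens.opensRange_ι]
    exact inf_eq_right.mpr h
  rw [morphismRestrict_app'] at h₁
  rw [Scheme.Hom.app_eq_appLE]
  exact (u.appLE_congr _ h₂ ((image_morphismRestrict_preimage u V _).trans (congrArg (u ⁻¹ᵁ ·) h₂))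
    fun g ↦ IsIso g).mp h₁

theorem isIso_morphismRestrict_of_forall (u : A ⟶ Y) {V : Y.Opens}
    (h : ∀ x ∈ V, ∃ W ≤ V, x ∈ W ∧ IsIso (u ∣_ W)) : IsIso (u ∣_ V) := by
  choose! W hWV hxW hW using h
  refine IsZariskiLocalAtTarget.of_iSup_eq_top (P := MorphismProperty.isomorphisms Scheme.{u})
    (fun x : V ↦ V.ι ⁻¹ᵁ W x) (top_le_iff.mp fun x _ ↦ ?_) fun x ↦ ?_
  · exact Opens.mem_iSup.mpr ⟨x, hxW _ x.2⟩
  · refine (MorphismProperty.arrow_mk_iso_iff _ (morphismRestrictRestrict u V _)).mpr ?_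
    have h₂ : V.ι ''ᵁ V.ι ⁻¹ᵁ W x = W x := by
      rw [Scheme.Hom.image_preimage_eq_opensRange_inf, Scheme.Opens.opensRange_ι]
      exact inf_eq_right.mpr (hWV _ x.2)
    rw [h₂]
    exact hW _ x.2

theorem isHomeomorph_of_isIso_morphismRestrict_compl (u : A ⟶ Y) [UniversallyClosed u]
    [Surjective u] {P : A} {V : Y.Opens} (hV : (V : Set Y) = {u P}ᶜ) (hV' : ((u ⁻¹ᵁ V : A.Opens) : Set A) = {P}ᶜ)
    [IsIso (u ∣_ V)] : IsHomeomorph u := by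
  rw [isHomeomorph_iff_continuous_isClosedMap_bijective]
  refine ⟨u.continuous, u.isClosedMap, fun x x' h ↦ ?_, u.surjective⟩
  have key : ∀ x, u x = u P → x = P := by
    intro x hx
    by_contra hne
    have : x ∈ ((u ⁻¹ᵁ V : A.Opens) : Set A) := hV' ▸ hne
    have h₂ : u x ∈ (V : Set Y) := this
    rw [hV] at h₂
    exact h₂ hx
  by_cases hx : x = P
  · subst hx; exact (key x' h.symm).symm
  · have hx' : x' ≠ P := by rintro rfl; exact hx (key x h)
    have m : x ∈ ((u ⁻¹ᵁ V : A.Opens) : Set A) := hV' ▸ hx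
    have m' : x' ∈ ((u ⁻¹ᵁ V : A.Opens) : Set A) := hV' ▸ hx'
    have hinj : Function.Injective (u ∣_ V) := (u ∣_ V).homeomorph.injective
    have : (⟨x, m⟩ : (u ⁻¹ᵁ V : A.Opens)) = ⟨x', m'⟩ := hinj (Subtype.ext
      ((morphismRestrict_base_coe u V ⟨x, m⟩).trans
        (h.trans (morphismRestrict_base_coe u V ⟨x', m'⟩).symm)))
    exact congrArg Subtype.val this

section Conductor

variable (u : A ⟶ Y) [IsSchemeTheoreticallyDominant u] [QuasiCompact u]

/-- A morphism is an isomorphism over the locus where a function in the conductor is invertible. -/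
theorem isIso_morphismRestrict_basicOpen [IsAffineHom u] {Y₀ : Y.Opens} (hY₀ : IsAffineOpen Y₀)
    (e : Γ(Y, Y₀)) (he : ∀ x, (u.app Y₀).hom e * x ∈ (u.app Y₀).hom.range) :
    IsIso (u ∣_ Y.basicOpen e) := by
  rw [isIso_morphismRestrict_iff_isIso_app _ (hY₀.basicOpen e), ConcreteCategory.isIso_iff_bijective]
  refine ⟨u.app_injective _, fun c ↦ ?_⟩
  have hle : u ⁻¹ᵁ Y.basicOpen e ≤ u ⁻¹ᵁ Y₀ := u.preimage_mono (Y.basicOpen_le e)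
  obtain ⟨n, x, hx⟩ := exists_pow_mul_eq_resHom (hY₀.preimage u) ((u.app Y₀).hom e)
    (Scheme.preimage_basicOpen u e) hle c
  obtain ⟨z, hz⟩ := he x
  obtain ⟨v, hv⟩ := isUnit_resHom_basicOpen (Y.basicOpen_le e) (le_refl (Y.basicOpen e))
  have hv' : (u.app (Y.basicOpen e)).hom v = resHom A hle ((u.app Y₀).hom e) := by
    rw [hv]; exact app_resHom u (Y.basicOpen_le e) e
  have hz' : (u.app (Y.basicOpen e)).hom (resHom Y (Y.basicOpen_le e) z) =
      resHom A hle ((u.app Y₀).hom e) * resHom A hle x := by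
    rw [← map_mul, ← hz]; exact app_resHom u (Y.basicOpen_le e) z
  have hinv : (u.app (Y.basicOpen e)).hom v * (u.app (Y.basicOpen e)).hom ↑v⁻¹ = 1 := by
    rw [← map_mul, Units.mul_inv, map_one]
  -- From `c e^n = x` and `e x = z` one gets `c = z / e^(n+1)`; the extra factor `e` brings the
  -- numerator into the image.
  refine ⟨resHom Y (Y.basicOpen_le e) z * ↑v⁻¹ ^ (n + 1), ?_⟩
  refine ((u.app (Y.basicOpen e)).hom.map_mul _ _).trans ?_
  rw [hz', map_pow, ← hx, ← hv', mul_left_comm, mul_assoc, ← pow_succ', ← mul_pow, hinv, one_pow, mul_one]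

variable {P : A} {Y₀ Y₁ : Y.Opens} (hP₀ : P ∈ u ⁻¹ᵁ Y₀)

/-- A morphism to a scheme with two affine charts which is an isomorphism over the second, and whose
conductor on the first contains the functions with germ at `P` in a power of the maximal ideal, is an
isomorphism away from `P`. -/
theorem exists_isIso_morphismRestrict_compl [Surjective u] (hY₀ : IsAffineOpen Y₀)
    (hY₁ : IsAffineOpen Y₁) (h₀₁ : Y₀ ⊔ Y₁ = ⊤) (hU : IsAffineOpen (u ⁻¹ᵁ Y₀))
    (hV : IsAffineOpen (u ⁻¹ᵁ Y₁)) (hP : IsClosed {P}) (hP₁ : P ∉ u ⁻¹ᵁ Y₁) (n : ℕ) (hn : n ≠ 0)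
    (hJ : ∀ x, germHom A hP₀ x ∈ IsLocalRing.maximalIdeal (A.presheaf.stalk P) ^ n →
      x ∈ (u.app Y₀).hom.range)
    (hsurj : Function.Surjective (u.app Y₁).hom) :
    IsIso (u ∣_ Y₁) ∧ ∃ V : Y.Opens, Y₁ ≤ V ∧ (V : Set Y) = {u P}ᶜ ∧
      ((u ⁻¹ᵁ V : A.Opens) : Set A) = {P}ᶜ ∧ IsIso (u ∣_ V) := by
  have : IsAffineHom u := by
    refine isAffineHom_of_forall_exists_isAffineOpen _ fun x ↦ ?_
    rcases (h₀₁ ▸ trivial : x ∈ Y₀ ⊔ Y₁) with h | h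
    exacts [⟨Y₀, h, hY₀, hU⟩, ⟨Y₁, h, hY₁, hV⟩]
  have h₁ : IsIso (u ∣_ Y₁) := by
    rw [isIso_morphismRestrict_iff_isIso_app _ hY₁, ConcreteCategory.isIso_iff_bijective]
    exact ⟨u.app_injective _, hsurj⟩
  let E : Set Γ(Y, Y₀) := {e | germHom A hP₀ ((u.app Y₀).hom e) ∈
    IsLocalRing.maximalIdeal (A.presheaf.stalk P) ^ n}
  -- Each `e` in `E` is in the conductor, because `𝔪^n` is an ideal whose sections all come from
  -- `Y₀`.
  let V : Y.Opens := Y₁ ⊔ ⨆ e : E, Y.basicOpen e.1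
  have hPV : P ∉ u ⁻¹ᵁ V := by
    rintro (h | h)
    · exact hP₁ h
    · obtain ⟨e, he⟩ := Opens.mem_iSup.mp h
      have he' : P ∈ u ⁻¹ᵁ Y.basicOpen e.1 := he
      rw [Scheme.preimage_basicOpen, ← isUnit_germHom_iff hP₀] at he'
      exact Ideal.pow_le_self hn e.2 he'
  have hV' : ∀ x, x ≠ P → x ∈ u ⁻¹ᵁ V := by
    intro x hx
    rcases (h₀₁ ▸ trivial : u x ∈ Y₀ ⊔ Y₁) with h | h
    · obtain ⟨b, hb, hxb⟩ := hU.exists_basicOpen_le (V := ⟨_, hP.isOpen_compl⟩) ⟨x, hx⟩ h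
      have hbP : germHom A hP₀ b ∈ IsLocalRing.maximalIdeal (A.presheaf.stalk P) := fun hu ↦
        hb ((isUnit_germHom_iff hP₀ b).mp hu) rfl
      have hbn : germHom A hP₀ (b ^ n) ∈ IsLocalRing.maximalIdeal (A.presheaf.stalk P) ^ n := by
        rw [map_pow]; exact Ideal.pow_mem_pow hbP n
      obtain ⟨e, he⟩ := hJ _ hbn
      refine Or.inr (Opens.mem_iSup.mpr ⟨⟨e, ?_⟩, ?_⟩)
      · change germHom A hP₀ ((u.app Y₀).hom e) ∈ IsLocalRing.maximalIdeal (A.presheaf.stalk P) ^ n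
        rw [he]; exact hbn
      · change x ∈ u ⁻¹ᵁ Y.basicOpen e
        rw [Scheme.preimage_basicOpen]
        change x ∈ A.basicOpen ((u.app Y₀).hom e)
        rw [he, Scheme.basicOpen_pow _ _ (Nat.pos_of_ne_zero hn)]
        exact hxb
    · exact Or.inl h
  refine ⟨h₁, V, le_sup_left, ?_, ?_, isIso_morphismRestrict_of_forall u ?_⟩
  · ext z
    obtain ⟨x, rfl⟩ := u.surjective z
    constructor
    · rintro h (h' : u x = u P)
      exact hPV (h' ▸ h : u P ∈ V)
    · intro h
      exact hV' x (by rintro rfl; exact h rfl)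
  · ext x
    exact ⟨fun h hx ↦ hPV (hx ▸ h), hV' x⟩
  · rintro x (h | h)
    · exact ⟨Y₁, le_sup_left, h, h₁⟩
    · obtain ⟨e, he⟩ := Opens.mem_iSup.mp h
      refine ⟨Y.basicOpen e.1, (le_iSup (fun e : E ↦ Y.basicOpen e.1) e).trans le_sup_right, he,
        isIso_morphismRestrict_basicOpen u hY₀ e.1 fun x ↦ hJ _ ?_⟩
      rw [map_mul]
      exact Ideal.mul_mem_right _ _ e.2

theorem stalkMap_injective_of_isAffineOpen [IsIntegral A]
    (hP₀ : P ∈ u ⁻¹ᵁ Y₀) (hY₀ : IsAffineOpen Y₀) :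
    Function.Injective (u.stalkMap P).hom := by
  refine hY₀.stalkMap_injective u P hP₀ fun g hg ↦ ?_
  have h : germHom A hP₀ ((u.app Y₀).hom g) = 0 :=
    (Scheme.Hom.germ_stalkMap_apply u Y₀ P hP₀ g).symm.trans hg
  have : Nonempty (u ⁻¹ᵁ Y₀ : A.Opens) := ⟨⟨P, hP₀⟩⟩
  have h₂ := germ_injective_of_isIntegral A P hP₀ (h.trans (map_zero _).symm)
  have h₃ := u.app_injective Y₀ (h₂.trans (map_zero (u.app Y₀).hom).symm)
  rw [h₃, map_zero]

end Conductor

/-- The image of the local ring at `u P`, when the ring of sections near `u P` consists of the sections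
near `P` with germ in `k + I`. -/
theorem range_stalkMap_eq {k : Type u} [Field k] (u : A ⟶ Y) {P : A} {Y₀ : Y.Opens}
    (hP₀ : P ∈ u ⁻¹ᵁ Y₀) (hY₀ : IsAffineOpen Y₀) (hU : IsAffineOpen (u ⁻¹ᵁ Y₀))
    (χ : k →+* A.presheaf.stalk P) (I : Ideal (A.presheaf.stalk P))
    [Finite (A.presheaf.stalk P ⧸ I)]
    (hr : (u.app Y₀).hom.range = (scalarAddIdeal χ I).comap (germHom A hP₀)) :
    Set.range (u.stalkMap P).hom = scalarAddIdeal χ I := by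
  have germ_eq : ∀ g, (u.stalkMap P).hom (germHom Y (P := u P) hP₀ g) =
      germHom A hP₀ ((u.app Y₀).hom g) := Scheme.Hom.germ_stalkMap_apply u Y₀ P hP₀
  have germ_mem : ∀ g, germHom A hP₀ ((u.app Y₀).hom g) ∈ scalarAddIdeal χ I := fun g ↦
    (hr ▸ ⟨g, rfl⟩ : (u.app Y₀).hom g ∈ (scalarAddIdeal χ I).comap (germHom A hP₀))
  have exists_eq : ∀ b, germHom A hP₀ b ∈ scalarAddIdeal χ I → ∃ g, (u.app Y₀).hom g = b :=
    fun b hb ↦ (hr ▸ hb : b ∈ (u.app Y₀).hom.range)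
  have le_range : ∀ t ∈ I, t ∈ (u.stalkMap P).hom.range := by
    intro t ht
    obtain ⟨d, b, hd, h⟩ := exists_mul_germHom_eq hU hP₀ t
    obtain ⟨n, hn⟩ := exists_mul_pow_sub_one_mem (I := I) hd
    -- Expand `t = b / d` by `d^n`: the numerator then has germ in `I` and the denominator in `1 +
    -- I`, so both descend to `Y₀`. The denominator stays invertible because the stalk map is local.
    obtain ⟨g₁, hg₁⟩ := exists_eq (b * d ^ n) <| mem_scalarAddIdeal_of_mem χ <| by
      rw [map_mul, ← h]
      exact I.mul_mem_right _ (I.mul_mem_right _ ht)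
    obtain ⟨g₂, hg₂⟩ := exists_eq (d * d ^ n) <| mem_scalarAddIdeal.mpr ⟨1, by
      rw [map_mul, map_pow, map_one]; exact hn⟩
    have hu : IsUnit (germHom Y (P := u P) hP₀ g₂) := by
      refine isUnit_of_map_unit (u.stalkMap P).hom _ ?_
      rw [germ_eq, hg₂, map_mul, map_pow]
      exact hd.mul (hd.pow n)
    obtain ⟨v, hv⟩ := hu
    refine ⟨germHom Y (P := u P) hP₀ g₁ * ↑v⁻¹, ?_⟩
    have hv' : germHom A hP₀ (d * d ^ n) * (u.stalkMap P).hom ↑v⁻¹ = 1 := by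
      rw [← hg₂, ← germ_eq, ← hv, ← map_mul, Units.mul_inv, map_one]
    have h₁ : germHom A hP₀ (b * d ^ n) = t * germHom A hP₀ (d * d ^ n) := by
      rw [map_mul, ← h, map_mul, mul_assoc]
    rw [map_mul, germ_eq, hg₁, h₁, mul_assoc, hv', mul_one]
  ext t
  constructor
  · rintro ⟨s, rfl⟩
    obtain ⟨d, b, hd, h⟩ := exists_mul_germHom_eq hY₀ (P := u P) hP₀ s
    have hd' : IsUnit (germHom A hP₀ ((u.app Y₀).hom d)) := by
      rw [← germ_eq]; exact hd.map _
    obtain ⟨n, hn⟩ := exists_mul_pow_sub_one_mem (I := I) hd'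
    have h' := congrArg (u.stalkMap P).hom h
    rw [map_mul, germ_eq, germ_eq] at h'
    -- Modulo `I`, the quotient `b / d` equals `b d^n`, which is in the subring.
    have e : (u.stalkMap P).hom s = germHom A hP₀ ((u.app Y₀).hom b) *
        germHom A hP₀ ((u.app Y₀).hom d) ^ n - (u.stalkMap P).hom s *
        (germHom A hP₀ ((u.app Y₀).hom d) * germHom A hP₀ ((u.app Y₀).hom d) ^ n - 1) := by
      rw [← h']; ring
    rw [e]
    exact sub_mem (mul_mem (germ_mem b) (pow_mem (germ_mem d) n))
      (mem_scalarAddIdeal_of_mem χ (I.mul_mem_left _ hn))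
  · intro ht
    obtain ⟨b, hb⟩ := exists_sub_germHom_mem hU hP₀ I t
    have hbD : germHom A hP₀ b ∈ scalarAddIdeal χ I := by
      have := sub_mem (show t ∈ scalarAddIdeal χ I from ht) (mem_scalarAddIdeal_of_mem χ hb)
      rwa [sub_sub_cancel] at this
    obtain ⟨g, hg⟩ := exists_eq b hbD
    have := add_mem (le_range _ hb) ⟨germHom Y (P := u P) hP₀ g, germ_eq g⟩
    rwa [hg, sub_add_cancel] at this

end CurveGenus

-- The image curve in projective space.

namespace CurveGenus

variable {k : Type u} [Field k] {A : Scheme.{u}} {a : A ⟶ Spec (.of k)}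

instance {X Z : Scheme.{u}} (f : X ⟶ Z) [QuasiCompact f] : IsSchemeTheoreticallyDominant f.toImage := by
  refine ⟨Scheme.IdealSheafData.ext_of_iSup_eq_top
    (fun W : Z.affineOpens ↦ ⟨f.imageι ⁻¹ᵁ W, W.2.preimage _⟩) ?_ fun W ↦ ?_⟩
  · rw [← Scheme.Hom.preimage_iSup, iSup_affineOpens_eq_top Z]
    rfl
  · rw [Scheme.Hom.ker_apply]
    exact (RingHom.injective_iff_ker_eq_bot _).mp (f.toImage_app_injective W)

/-- A morphism to a closed subscheme of projective space, its image, with prescribed coordinate rings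
on two affine charts. -/
theorem exists_image_projSpace [IsProper a] (c : Charts A)
    {R : Subring Γ(A, c.U)} {m : ℕ} (b : Fin m → Γ(A, c.U))
    (hb : (MvPolynomial.eval₂Hom (scalarHom a c.U) b).range = R) (n₀ : ℕ)
    (hR : ∀ x, c.h ^ n₀ * x ∈ R) :
    ∃ (Y : Scheme.{u}) (u : A ⟶ Y) (b : Y ⟶ Spec (.of k)) (Y₀ Y₁ : Y.Opens) (h₀ : c.U = u ⁻¹ᵁ Y₀)
      (h₁ : c.V = u ⁻¹ᵁ Y₁), IsProjective b ∧ u ≫ b = a ∧ IsSchemeTheoreticallyDominant u ∧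
      UniversallyClosed u ∧ Surjective u ∧ IsAffineOpen Y₀ ∧ IsAffineOpen Y₁ ∧ Y₀ ⊔ Y₁ = ⊤ ∧
      (u.appLE Y₀ c.U h₀.le).hom.range = R ∧ (u.appLE Y₁ c.V h₁.le).hom.range = ⊤ := by
  obtain ⟨M, φ, Z₀, Z₁, h₀, h₁, hφ, hZ₀, hZ₁, hr₀, hr₁⟩ :=
    exists_hom_projSpace_of_subring a c b hb n₀ hR
  have : IsProper (φ ≫ ProjSpace.toSpec k M) := hφ ▸ ‹_›
  have : IsProper φ := .of_comp φ (ProjSpace.toSpec k M)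
  have hcomp := φ.toImage_imageι
  have pre : ∀ Z : (ProjSpace k M).Opens, φ.toImage ⁻¹ᵁ φ.imageι ⁻¹ᵁ Z = φ ⁻¹ᵁ Z := fun Z ↦ by
    rw [← Scheme.Hom.comp_preimage, hcomp]
  -- Sections over an affine open of projective space surject onto those of the closed subscheme, so
  -- passing to the image does not change the range.
  have range_eq : ∀ (Z : (ProjSpace k M).Opens) (_ : IsAffineOpen Z) (W : A.Opens)
      (h : W ≤ φ ⁻¹ᵁ Z), (φ.toImage.appLE (φ.imageι ⁻¹ᵁ Z) W (h.trans (pre Z).ge)).hom.range =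
        (φ.appLE Z W h).hom.range := by
    intro Z hZ W h
    have e : φ.imageι.appLE Z (φ.imageι ⁻¹ᵁ Z) le_rfl ≫
        φ.toImage.appLE (φ.imageι ⁻¹ᵁ Z) W (h.trans (pre Z).ge) = φ.appLE Z W h := by
      rw [Scheme.Hom.appLE_comp_appLE]
      simp only [hcomp]
    rw [← e, CommRingCat.hom_comp, ← RingHom.map_range, ← Scheme.Hom.app_eq_appLE,
      RingHom.range_eq_top.mpr (φ.ker.subschemeι_app_surjective ⟨Z, hZ⟩), RingHom.range_eq_map]
  refine ⟨φ.image, φ.toImage, φ.imageι ≫ ProjSpace.toSpec k M, φ.imageι ⁻¹ᵁ Z₀, φ.imageι ⁻¹ᵁ Z₁,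
    h₀.trans (pre _).symm, h₁.trans (pre _).symm, ⟨M, φ.imageι, inferInstance, rfl⟩, ?_, inferInstance,
    inferInstance, inferInstance, hZ₀.preimage _, hZ₁.preimage _, ?_, (range_eq _ hZ₀ _ _).trans hr₀,
    (range_eq _ hZ₁ _ _).trans hr₁⟩
  · rw [← Category.assoc, hcomp, hφ]
  · refine top_le_iff.mp fun z _ ↦ ?_
    obtain ⟨x, rfl⟩ := φ.toImage.surjective z
    rcases (c.sup_eq_top ▸ trivial : x ∈ c.U ⊔ c.V) with h | h
    · rw [h₀, ← pre] at h
      exact Or.inl h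
    · rw [h₁, ← pre] at h
      exact Or.inr h

end CurveGenus

end

-- Construction of `Y` and verification of its properties.

open CurveGenus

theorem lemmae3 {k : Type u} [Field k] [Finite k]
    {A : Scheme.{u}} (a : A ⟶ Spec (CommRingCat.of k)) (hA : CurveGenus.IsCurve a)
    (p : Spec (CommRingCat.of k) ⟶ A) (hp : p ≫ a = 𝟙 (Spec (CommRingCat.of k)))
    (P : A) (hP : P = p (IsLocalRing.closedPoint k))
    (hreg : IsRegularLocalRing (A.presheaf.stalk P))
    (y : ℕ) (hy : 0 < y) :
    ∃ (Y : Scheme.{u}) (b : Y ⟶ Spec (CommRingCat.of k)) (u : A ⟶ Y),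
      CurveGenus.IsCurve b ∧
      u ≫ b = a ∧
      (∃ V : Y.Opens, (V : Set Y) = {u P}ᶜ ∧ ((u ⁻¹ᵁ V : A.Opens) : Set A) = {P}ᶜ ∧
        IsIso (u ∣_ V)) ∧
      CurveGenus.arithmeticGenus b = CurveGenus.arithmeticGenus a + (y : ℤ) ∧
      Function.Injective (u.stalkMap P).hom ∧
      Set.range (u.stalkMap P).hom =
        {s : A.presheaf.stalk P | ∃ c : k,
          ∃ t ∈ IsLocalRing.maximalIdeal (A.presheaf.stalk P) ^ (y + 1),
            s = CurveGenus.stalkScalarHom a P c + t} := by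
  have := hA.isProper
  have := hA.isIntegral
  have := hA.isNoetherian
  have := hA.geometricallyIntegral
  have hPc : IsClosed {P} := hP ▸ isClosed_singleton_of_section a p hp
  have hχ : ∀ s, ∃ c, s - stalkScalarHom a P c ∈ IsLocalRing.maximalIdeal (A.presheaf.stalk P) := by
    subst hP; exact exists_sub_stalkScalarHom_mem a p hp
  obtain ⟨U, V, h, h', hU, hV, hUV, hPU, hPV, hη, hh, hh', hmul⟩ := hA.exists_charts hPc
  -- The function `h` vanishes at `P` but is nonzero at the generic point, so its germ at `P` is a
  -- nonzero nonunit.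
  have hO : ¬ IsField (A.presheaf.stalk P) := by
    refine not_isField_stalk hPU (h := h) (fun h0 ↦ ?_) fun hm ↦ hPV (hh ▸ hm : P ∈ U ⊓ V).2
    have hηU : genericPoint A ∈ U :=
      ((genericPoint_spec A).mem_open_set_iff U.2).mpr (by simpa using ⟨P, hPU⟩)
    have : genericPoint A ∈ A.basicOpen h := hh ▸ ⟨hηU, hη⟩
    rw [h0] at this
    exact this
  have hdim : ringKrullDim (A.presheaf.stalk P) ≤ 1 :=
    (ringKrullDim_stalk_le P).trans hA.dim_eq_one.le
  have hcard := card_quotient_maximalIdeal_pow hdim hO _ hχ (y + 1)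
  have hfin : Finite (A.presheaf.stalk P ⧸ IsLocalRing.maximalIdeal (A.presheaf.stalk P) ^ (y + 1)) :=
    Nat.finite_of_card_ne_zero (hcard ▸ pow_ne_zero _ Nat.card_pos.ne')
  have hidx := index_comap_scalarAddIdeal (stalkScalarHom a P) hcard (germHom A hPU) (exists_sub_germHom_mem hU hPU _)
  obtain ⟨m, g, hg⟩ := exists_range_eval₂Hom_eq_of_index_ne_zero (scalarHom a U)
    (finiteType_scalarHom a hU)
    ((scalarAddIdeal (stalkScalarHom a P)
      (IsLocalRing.maximalIdeal (A.presheaf.stalk P) ^ (y + 1))).comap (germHom A hPU))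
    (fun c ↦ by
      rw [Subring.mem_comap, germHom_scalarHom]
      exact coe_mem_scalarAddIdeal _ _ c)
    (hidx ▸ pow_ne_zero _ Nat.card_pos.ne')
  have hhP : germHom A hPU h ∈ IsLocalRing.maximalIdeal (A.presheaf.stalk P) := fun hu ↦
    hPV (hh ▸ (isUnit_germHom_iff hPU h).mp hu : P ∈ U ⊓ V).2
  -- The exponent `y + 1` works as `n₀`: since the germ of `h` lies in `𝔪`, every multiple of
  -- `h^(y+1)` has germ in `𝔪^(y+1)`.
  obtain ⟨Y, u, b, Y₀, Y₁, h₀, h₁, hb, hub, _, _, _, hY₀, hY₁, hY, hr₀, hr₁⟩ := exists_image_projSpace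
    ⟨U, V, h, h', hU, hV, hUV, hh, hh', hmul⟩ g hg (y + 1) fun x ↦ by
      rw [Subring.mem_comap, map_mul, map_pow]
      exact mem_scalarAddIdeal_of_mem _ (Ideal.mul_mem_right _ _ (Ideal.pow_mem_pow hhP _))
  change U = u ⁻¹ᵁ Y₀ at h₀
  change V = u ⁻¹ᵁ Y₁ at h₁
  subst h₀ h₁
  rw [← Scheme.Hom.app_eq_appLE] at hr₀ hr₁
  obtain ⟨hiso, O, hYO, hO₁, hO₂, hO₃⟩ := exists_isIso_morphismRestrict_compl u hPU hY₀ hY₁ hY hU hV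
    hPc hPV (y + 1) y.succ_ne_zero
    (fun x hx ↦ hr₀ ▸ mem_scalarAddIdeal_of_mem (stalkScalarHom a P) hx) (RingHom.range_eq_top.mp hr₁)
  have hhomeo := isHomeomorph_of_isIso_morphismRestrict_compl u hO₁ hO₂
  have hgi : GeometricallyIntegral (u ≫ b) := hub ▸ ‹_›
  have := finite_H_zero a
  have := finite_H_one a ⟨_, _, h, h', hU, hV, hUV, hh, hh', hmul⟩
  refine ⟨Y, b, u, ⟨hb, geometricallyIntegral_of_surjective u b,
    (hhomeo.topologicalKrullDim_eq u).symm.trans hA.dim_eq_one⟩, hub, ⟨O, hO₁, hO₂, hO₃⟩,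
    arithmeticGenus_eq_add a b u hY₀ hY₁ hY hU hV (u.app_injective _) y ?_
      ⟨u.app_injective _, RingHom.range_eq_top.mp hr₁⟩ ?_,
    stalkMap_injective_of_isAffineOpen u hPU hY₀, ?_⟩
  · rw [← hidx, ← hr₀]
    rfl
  · have := isIso_app_of_le u (inf_le_right : Y₀ ⊓ Y₁ ≤ Y₁)
    exact ConcreteCategory.bijective_of_isIso (u.app (Y₀ ⊓ Y₁))
  · rw [range_stalkMap_eq u hPU hY₀ hU _ _ hr₀]
    ext s
    refine mem_scalarAddIdeal.trans (exists_congr fun c ↦ ⟨fun hs ↦ ⟨_, hs, by abel⟩, ?_⟩)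
    rintro ⟨t, ht, rfl⟩
    simpa using ht
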